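/- Let $\mathcal P$ be the Poisson point process with unit intensity (with respect to Lebesgue measure) in the quadrant $\mathbb R_+^2$, regarded as a random set, and let $k\ge 1$ be an integer. A point $b=(s,y)$ is strictly south-west from $a=(t,x)$ if $s<t$ and $y<x$, strictly west from $a$ if $s<t$ and $y=x$, and strictly south from $a$ if $s=t$ and $y<x$. Let $\mathcal R^{(k)}$ (the $k$-records) be the set of $a\in\mathcal P$ such that exactly $k-1$ points of $\mathcal P$ lie strictly south-west from $a$. Let $\mathcal C^{(k)}$ (the $k$-corners) be the union of $\mathcal R^{(k)}$ and the set of points $a\in\mathbb R_+^2\setminus\mathcal P$ such that exactly $k-2$ points of $\mathcal P$ lie strictly south-west from $a$, some point of $\mathcal P$ lies strictly west from $a$, and some point of $\mathcal P$ lies strictly south from $a$ (for $k=1$ there are no points of this second kind). Then $\mathcal C^{(k)}$ and $\mathcal R^{(k)}$ are point processes, and the law of $\mathcal R^{(k)}$ is that of the Bernoulli thinning of $\mathcal C^{(k)}$ with retention probability $1/k$, that is, of the point process obtained from $\mathcal C^{(k)}$ by keeping, given $\mathcal C^{(k)}$, each of its points with probability $1/k$, independently of the other points. In particular, the intensity measure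 of $\mathcal C^{(k)}$ is $k$ times that of $\mathcal R^{(k)}$: $\mathbb E\,\#(\mathcal C^{(k)}\cap B)=k\,\mathbb E\,\#(\mathcal R^{(k)}\cap B)$ for every Borel set $B\subset\mathbb R_+^2$. -/

import Mathlib

open MeasureTheory ProbabilityTheory Set
open scoped ENNReal

noncomputable section

/-! ### Point processes as random sets -/

/-- The counting measure `∑_{a ∈ S} δ_a` of a set of points `S`: a Borel set `B` gets the number
(possibly `∞`) of points of `S ∩ B`. A simple point process is handled as a random set; its law is
the law of the associated random counting measure, with respect to Mathlib's `σ`-algebra on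
`Measure E` (generated by the maps `ν ↦ ν B`, `B` measurable). -/
def pointMeasure {E : Type*} [MeasurableSpace E] (S : Set E) : Measure E :=
  Measure.sum fun a : S => Measure.dirac (a : E)

/-- The random set `P` is a Poisson point process with intensity measure `μ`. -/
structure IsPoissonPointProcess {Ω E : Type*} [MeasurableSpace Ω] [MeasurableSpace E]
    (P : Ω → Set E) (μ : Measure E) (Pr : Measure Ω) : Prop where
  /-- `P` is a random point configuration. -/
  measurable : Measurable fun ω => pointMeasure (P ω)
  /-- The number of points in a set `B` of finite measure has the Poisson law of mean `μ B`. -/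
  hasLaw_count : ∀ B : Set E, MeasurableSet B → μ B ≠ ∞ →
    HasLaw (fun ω => pointMeasure (P ω) B)
      ((poissonMeasure (μ B).toNNReal).map fun n : ℕ => (n : ℝ≥0∞)) Pr
  /-- The numbers of points in finitely many disjoint sets are independent. -/
  iIndepFun_count : ∀ (n : ℕ) (B : Fin n → Set E), (∀ i, MeasurableSet (B i)) →
    Pairwise (fun i j => Disjoint (B i) (B j)) →
    iIndepFun (fun i ω => pointMeasure (P ω) (B i)) Pr

/-- The law of the point process obtained from a (countable) deterministic set `S` by keeping each
of its points with probability `p`, independently of the other points. -/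
def bernoulliThinning {E : Type*} [MeasurableSpace E] (p : unitInterval) (S : Set E) :
    Measure (Measure E) :=
  (setBernoulli S p).map fun A => pointMeasure (A ∩ S)

/-- The law of the Bernoulli thinning with retention probability `p` of the point process `C`:
given `C`, each of its points is kept with probability `p`, independently of the others. -/
def bernoulliThinningLaw {Ω E : Type*} [MeasurableSpace Ω] [MeasurableSpace E]
    (p : unitInterval) (C : Ω → Set E) (Pr : Measure Ω) : Measure (Measure E) :=
  Pr.bind fun ω => bernoulliThinning p (C ω)

/-- The number `1 / k` as an element of `[0, 1]`. -/
def oneDivNat (k : ℕ) : unitInterval :=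
  ⟨1 / (k : ℝ), by positivity, by rw [one_div]; exact Nat.cast_inv_le_one k⟩

/-! ### Corners and records -/

/-- The quadrant `ℝ₊²`; a point is `a = (t, x)`, with `t` its time and `x` its value. -/
def quadrant : Set (ℝ × ℝ) := Ici 0 ×ˢ Ici 0

/-- The points of `S` strictly south-west from `a`. -/
def southWest (S : Set (ℝ × ℝ)) (a : ℝ × ℝ) : Set (ℝ × ℝ) :=
  {b ∈ S | b.1 < a.1 ∧ b.2 < a.2}

/-- The `k`-records of `S`: the points of `S` with exactly `k - 1` points of `S` strictly
south-west from them. -/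
def kRecords (k : ℕ) (S : Set (ℝ × ℝ)) : Set (ℝ × ℝ) :=
  {a ∈ quadrant | a ∈ S ∧ (southWest S a).encard + 1 = k}

/-- The `k`-corners of `S`: the `k`-records, together with the points `a ∉ S` with exactly `k - 2`
points of `S` strictly south-west from `a`, a point `c ∈ S` strictly west from `a` and a point
`d ∈ S` strictly south from `a`. (There are none of the second kind if `k = 1`.) -/
def kCorners (k : ℕ) (S : Set (ℝ × ℝ)) : Set (ℝ × ℝ) :=
  kRecords k S ∪
    {a ∈ quadrant | a ∉ S ∧ (southWest S a).encard + 2 = k ∧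
      (∃ c ∈ S, c.1 < a.1 ∧ c.2 = a.2) ∧ (∃ d ∈ S, d.1 = a.1 ∧ d.2 < a.2)}

end

/-! Corners and records depend only on the relative order of the coordinates, and, given the times
and the values of its points, the Poisson process in a box is a uniformly random bijection between
them. For such a bijection the points are added in order of time. Let `a` be the last time, `V` the
set of values and `w` the `k`-th smallest element of `V`, if there is one. The last point `(a, v)`
does not alter the other columns. Its own column contains a corner exactly when `v ≤ w`; the corner
is then `(a, w)`, and it is a record exactly when `v = w` (`mem_kCorners_insert_last`,
`mem_kRecords_insert_last`). So one of `k` equally likely choices of `v` makes the corner a record.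
This choice is independent of the earlier records: once some `v ≤ w` is taken away, only `k - 1`
values up to `w` remain, whereas a `k`-corner has at least `k` points not above it. Hence the
earlier records lie above `w` and do not change when `v` and `w` exchange labels
(`kRecords_mapValue`). Induction on the set of times gives `sum_kRecords_eq_sum_thinSum`.

Discretisation replaces conditioning. In a grid of mesh `1 / L` on `[0, M)²`, the probability of a
pattern of singly occupied cells depends only on the number of these cells
(`exists_measure_cellSet`), and with probability tending to one no row or column holds two points
(`measure_goodSet_compl_le`). On that event rounding preserves the order, hence commutes with taking
corners and records, and it leaves the counts in a rational rectangle unchanged once `L` is a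
multiple of the denominators. These counts determine the law of a locally finite random measure
(`measure_ext_of_cylinderSet`). The statement on intensities is the mean of a thinning
(`lintegral_bernoulliThinning`). -/

/-! ### Finite Bernoulli thinnings -/

/-- The mean of `Φ` over the random subset of the finite set `F` which keeps each point with
weight `p` and discards it with weight `q`. -/
noncomputable def thinSum {E : Type*} (p q : ℝ≥0∞) (F : Finset E) (Φ : Set E → ℝ≥0∞) : ℝ≥0∞ :=
  ∑ A ∈ F.powerset, p ^ A.card * q ^ (F.card - A.card) * Φ A

/-- Condition on the fate of `c`, which is discarded with weight `q` and kept with weight `p`. In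
the induction `c` is the corner created by the last column. -/
theorem thinSum_insert {E : Type*} [DecidableEq E] (p q : ℝ≥0∞) {F : Finset E} {c : E}
    (hc : c ∉ F) (Φ : Set E → ℝ≥0∞) :
    thinSum p q (insert c F) Φ =
      q * thinSum p q F Φ + p * thinSum p q F (fun A => Φ (insert c A)) := by
  unfold thinSum
  rw [Finset.sum_powerset_insert hc, Finset.mul_sum, Finset.mul_sum]
  congr 1
  · refine Finset.sum_congr rfl fun A hA => ?_
    have := Finset.card_le_card (Finset.mem_powerset.1 hA)
    rw [Finset.card_insert_of_notMem hc, Nat.sub_add_comm this, pow_succ]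
    ring
  · refine Finset.sum_congr rfl fun A hA => ?_
    have hcA : c ∉ A := fun h => hc (Finset.mem_powerset.1 hA h)
    rw [Finset.card_insert_of_notMem hc, Finset.card_insert_of_notMem hcA,
      Nat.add_sub_add_right, pow_succ, Finset.coe_insert]
    ring

theorem thinSum_image {E E' : Type*} [DecidableEq E'] (p q : ℝ≥0∞) {F : Finset E} {g : E → E'}
    (hg : InjOn g F) (Φ : Set E' → ℝ≥0∞) :
    thinSum p q (F.image g) Φ = thinSum p q F (fun A => Φ (g '' A)) := by
  unfold thinSum
  rw [Finset.powerset_image, Finset.sum_image]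
  · refine Finset.sum_congr rfl fun A hA => ?_
    rw [Finset.card_image_of_injOn hg,
      Finset.card_image_of_injOn (hg.mono (Finset.coe_subset.2 (Finset.mem_powerset.1 hA))),
      Finset.coe_image]
  · intro A hA B hB hAB
    have hA' := Finset.coe_subset.2 (Finset.mem_powerset.1 hA)
    have hB' := Finset.coe_subset.2 (Finset.mem_powerset.1 hB)
    have h : g '' (A : Set E) = g '' (B : Set E) := by
      rw [← Finset.coe_image, ← Finset.coe_image]; exact congrArg _ hAB
    exact Finset.coe_injective ((hg.image_eq_image_iff hA' hB').1 h)

/-! ### Corners and records of finite sets -/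

theorem kRecords_subset_kCorners (k : ℕ) (S : Set (ℝ × ℝ)) : kRecords k S ⊆ kCorners k S :=
  subset_union_left

/-- The times of corners are times of points, and the values of corners are values of points. -/
theorem kCorners_subset_prod (k : ℕ) (S : Set (ℝ × ℝ)) :
    kCorners k S ⊆ (Prod.fst '' S) ×ˢ (Prod.snd '' S) := by
  rintro a (ha | ⟨-, -, -, ⟨c, hc, -, hca⟩, ⟨d, hd, hda, -⟩⟩)
  · exact ⟨⟨a, ha.2.1, rfl⟩, ⟨a, ha.2.1, rfl⟩⟩
  · exact ⟨⟨d, hd, hda⟩, ⟨c, hc, hca⟩⟩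

theorem kCorners_finite (k : ℕ) {S : Set (ℝ × ℝ)} (hS : S.Finite) : (kCorners k S).Finite :=
  ((hS.image _).prod (hS.image _)).subset (kCorners_subset_prod k S)

/-- The finite set of `k`-corners of a finite set. -/
noncomputable def cornerFinset (k : ℕ) (S : Finset (ℝ × ℝ)) : Finset (ℝ × ℝ) :=
  (kCorners_finite k S.finite_toSet).toFinset

@[simp]
theorem coe_cornerFinset (k : ℕ) (S : Finset (ℝ × ℝ)) : (cornerFinset k S : Set (ℝ × ℝ)) =
    kCorners k S := by
  simp [cornerFinset]

/-- There are at least `k` points not above a `k`-corner. -/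
theorem le_encard_of_mem_kCorners {k : ℕ} {S : Set (ℝ × ℝ)} {b : ℝ × ℝ} (hb : b ∈ kCorners k S) :
    (k : ℕ∞) ≤ {s ∈ S | s.2 ≤ b.2}.encard := by
  rcases hb with ⟨-, hbS, hk⟩ | ⟨-, hbS, hk, ⟨c, hc, hc1, hc2⟩, ⟨d, hd, hd1, hd2⟩⟩
  · have hb' : b ∉ southWest S b := fun h => lt_irrefl _ h.2.1
    rw [← hk, ← encard_insert_of_notMem hb']
    refine encard_le_encard ?_
    rintro s (rfl | hs)
    · exact ⟨hbS, le_rfl⟩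
    · exact ⟨hs.1, hs.2.2.le⟩
  -- A corner of the second kind has only `k - 2` points strictly south-west. The western witness
  -- `c` and the southern witness `d` supply the other two.
  · have hd' : d ∉ southWest S b := fun h => h.2.1.ne hd1
    have hc' : c ∉ insert d (southWest S b) := by
      rintro (rfl | h)
      · rw [hd1] at hc1; exact lt_irrefl _ hc1
      · have := h.2.2; rw [hc2] at this; exact lt_irrefl _ this
    have : (southWest S b).encard + 2 = (insert c (insert d (southWest S b))).encard := by
      rw [encard_insert_of_notMem hc', encard_insert_of_notMem hd', add_assoc]; rfl
    rw [← hk, this]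
    refine encard_le_encard ?_
    rintro s (rfl | rfl | hs)
    · exact ⟨hc, hc2.le⟩
    · exact ⟨hd, hd2.le⟩
    · exact ⟨hs.1, hs.2.2.le⟩

/-- Relabel the values of a set of points. -/
def mapValue (τ : Equiv.Perm ℝ) : ℝ × ℝ ≃ ℝ × ℝ := (Equiv.refl ℝ).prodCongr τ

@[simp] theorem mapValue_fst (τ : Equiv.Perm ℝ) (a : ℝ × ℝ) : (mapValue τ a).1 = a.1 := rfl
@[simp] theorem mapValue_snd (τ : Equiv.Perm ℝ) (a : ℝ × ℝ) : (mapValue τ a).2 = τ a.2 := rfl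

/-! ### Permutations of the low values -/

section Relabel

variable {τ : Equiv.Perm ℝ} {w : ℝ}

/-- Since `τ` is injective and fixes every value above `w`, no value up to `w` can be sent above
`w`. Comparison with a level above `w` is therefore blind to `τ`. -/
theorem apply_le_of_fixed (hτ : ∀ y, w < y → τ y = y) {y : ℝ} (hy : y ≤ w) : τ y ≤ w := by
  by_contra! h
  have := τ.injective (hτ _ h)
  rw [this] at h
  exact absurd hy (not_le.2 h)

theorem apply_lt_iff_of_fixed (hτ : ∀ y, w < y → τ y = y) {y z : ℝ} (hz : w < z) :
    τ y < z ↔ y < z := by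
  rcases le_or_gt y w with h | h
  · exact iff_of_true ((apply_le_of_fixed hτ h).trans_lt hz) (h.trans_lt hz)
  · rw [hτ y h]

theorem mem_mapValue_image_iff (hτ : ∀ y, w < y → τ y = y) {S : Set (ℝ × ℝ)} {b : ℝ × ℝ}
    (hb : w < b.2) : b ∈ mapValue τ '' S ↔ b ∈ S := by
  have : mapValue τ b = b := Prod.ext rfl (hτ _ hb)
  conv_lhs => rw [← this]
  exact (mapValue τ).injective.mem_set_image

theorem encard_southWest_mapValue (hτ : ∀ y, w < y → τ y = y) (S : Set (ℝ × ℝ)) {b : ℝ × ℝ}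
    (hb : w < b.2) : (southWest (mapValue τ '' S) b).encard = (southWest S b).encard := by
  have : southWest (mapValue τ '' S) b = mapValue τ '' southWest S b := by
    ext s
    constructor
    · rintro ⟨⟨r, hr, rfl⟩, h1, h2⟩
      exact ⟨r, ⟨hr, h1, (apply_lt_iff_of_fixed hτ hb).1 h2⟩, rfl⟩
    · rintro ⟨r, ⟨hr, h1, h2⟩, rfl⟩
      exact ⟨⟨r, hr, rfl⟩, h1, (apply_lt_iff_of_fixed hτ hb).2 h2⟩
  rw [this, (mapValue τ).injective.encard_image]

theorem encard_le_mapValue (hτ : ∀ y, w < y → τ y = y) (S : Set (ℝ × ℝ)) :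
    {s ∈ mapValue τ '' S | s.2 ≤ w}.encard = {s ∈ S | s.2 ≤ w}.encard := by
  have : {s ∈ mapValue τ '' S | s.2 ≤ w} = mapValue τ '' {s ∈ S | s.2 ≤ w} := by
    ext s
    constructor
    · rintro ⟨⟨r, hr, rfl⟩, h1⟩
      refine ⟨r, ⟨hr, ?_⟩, rfl⟩
      by_contra! h
      simp only [mapValue_snd, hτ _ h] at h1
      exact absurd h1 (not_le.2 h)
    · rintro ⟨r, ⟨hr, h1⟩, rfl⟩
      exact ⟨⟨r, hr, rfl⟩, apply_le_of_fixed hτ h1⟩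
  rw [this, (mapValue τ).injective.encard_image]

/-- By `le_encard_of_mem_kCorners`, a corner at height at most `w` would need `k` points up to `w`.
All corners thus lie in the region that a relabelling of the low values leaves alone. -/
theorem lt_snd_of_mem_kCorners {k : ℕ} {S : Set (ℝ × ℝ)}
    (hS : {s ∈ S | s.2 ≤ w}.encard < k) {b : ℝ × ℝ} (hb : b ∈ kCorners k S) : w < b.2 := by
  by_contra! h
  refine absurd hS (not_lt.2 ((le_encard_of_mem_kCorners hb).trans (encard_le_encard ?_)))
  exact fun s hs => ⟨hs.1, hs.2.trans h⟩

/-- Permuting the values up to `w` does not alter the `k`-records if there are fewer than `k` of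
them. -/
theorem kRecords_mapValue (hτ : ∀ y, w < y → τ y = y) {k : ℕ} {S : Set (ℝ × ℝ)}
    (hS : {s ∈ S | s.2 ≤ w}.encard < k) : kRecords k (mapValue τ '' S) = kRecords k S := by
  have key : ∀ b : ℝ × ℝ, w < b.2 → (b ∈ kRecords k (mapValue τ '' S) ↔ b ∈ kRecords k S) := by
    intro b hb
    simp only [kRecords, mem_ofPred_eq, mem_mapValue_image_iff hτ hb,
      encard_southWest_mapValue hτ S hb]
  ext b
  constructor
  · intro h
    exact (key b (lt_snd_of_mem_kCorners ((encard_le_mapValue hτ S).trans_lt hS)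
      (kRecords_subset_kCorners _ _ h))).1 h
  · intro h
    exact (key b (lt_snd_of_mem_kCorners hS (kRecords_subset_kCorners _ _ h))).2 h

end Relabel

/-! ### Adding a last point -/

section Insert

variable {k : ℕ} {S : Set (ℝ × ℝ)} {a v : ℝ}

theorem southWest_insert_of_le {b : ℝ × ℝ} (hb : b.1 ≤ a) :
    southWest (insert (a, v) S) b = southWest S b := by
  ext s
  constructor
  · rintro ⟨rfl | hs, h⟩
    · exact absurd h.1 (not_lt.2 hb)
    · exact ⟨hs, h⟩
  · rintro ⟨hs, h⟩
    exact ⟨Or.inr hs, h⟩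

/-- All points of `S` precede time `a`, so only the values matter, and distinct points have distinct
values. -/
theorem encard_southWest_last (hS : ∀ s ∈ S, s.1 < a) (hinj : InjOn Prod.snd S) (y : ℝ) :
    (southWest S (a, y)).encard = {z ∈ Prod.snd '' S | z < y}.encard := by
  rw [← (hinj.mono fun s hs => hs.1 : InjOn Prod.snd (southWest S (a, y))).encard_image]
  congr 1
  ext z
  constructor
  · rintro ⟨s, hs, rfl⟩
    exact ⟨⟨s, hs.1, rfl⟩, hs.2.2⟩
  · rintro ⟨⟨s, hs, rfl⟩, hz⟩
    exact ⟨s, ⟨hs, hS s hs, hz⟩, rfl⟩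

theorem mem_kRecords_insert_of_ne (hS : ∀ s ∈ S, s.1 < a) {b : ℝ × ℝ} (hb : b.1 ≠ a) :
    b ∈ kRecords k (insert (a, v) S) ↔ b ∈ kRecords k S := by
  have hne : b ≠ (a, v) := fun h => hb (by rw [h])
  rcases lt_or_gt_of_ne hb with h | h
  · simp only [kRecords, mem_ofPred_eq, southWest_insert_of_le h.le, mem_insert_iff, hne, false_or]
  · have : b ∉ S := fun hbS => absurd (hS b hbS) h.not_gt
    simp [kRecords, hne, this]

/-- The new point is neither west, south nor south-west of anything in an earlier column. Later
columns hold no corner, because the time of a corner is the time of a point. -/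
theorem mem_kCorners_insert_of_ne (hS : ∀ s ∈ S, s.1 < a) {b : ℝ × ℝ} (hb : b.1 ≠ a) :
    b ∈ kCorners k (insert (a, v) S) ↔ b ∈ kCorners k S := by
  have hne : b ≠ (a, v) := fun h => hb (by rw [h])
  rcases lt_or_gt_of_ne hb with h | h
  · have h1 : ¬ (a < b.1 ∧ v = b.2) := fun h' => h'.1.not_gt h
    have h2 : ¬ (a = b.1 ∧ v < b.2) := fun h' => hb h'.1.symm
    unfold kCorners
    rw [mem_union, mem_union, mem_kRecords_insert_of_ne hS hb]
    simp only [mem_ofPred_eq, southWest_insert_of_le h.le, mem_insert_iff, hne, false_or,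
      exists_eq_or_imp, h1, h2]
  · refine iff_of_false (fun h' => ?_) (fun h' => ?_)
    · obtain ⟨s, rfl | hs, hsb⟩ := (kCorners_subset_prod _ _ h').1
      · exact hb hsb.symm
      · exact absurd (hS s hs) (by rw [hsb]; exact h.not_gt)
    · obtain ⟨s, hs, hsb⟩ := (kCorners_subset_prod _ _ h').1
      exact absurd (hS s hs) (by rw [hsb]; exact h.not_gt)

theorem notMem_kCorners_last (hS : ∀ s ∈ S, s.1 < a) (y : ℝ) : (a, y) ∉ kCorners k S := by
  intro h
  obtain ⟨s, hs, hsb⟩ := (kCorners_subset_prod _ _ h).1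
  have := hS s hs
  rw [hsb] at this
  exact lt_irrefl _ this

theorem mem_kRecords_insert_last (hS : ∀ s ∈ S, s.1 < a) (hinj : InjOn Prod.snd S)
    (hq : (a, v) ∈ quadrant) (y : ℝ) : (a, y) ∈ kRecords k (insert (a, v) S) ↔
      y = v ∧ {z ∈ Prod.snd '' S | z < v}.encard + 1 = k := by
  have haS : (a, y) ∉ S := fun h => lt_irrefl _ (hS _ h)
  constructor
  · rintro ⟨-, h | h, h'⟩
    · rw [Prod.mk.injEq] at h
      obtain ⟨-, rfl⟩ := h
      rw [southWest_insert_of_le (b := (a, _)) (le_refl a), encard_southWest_last hS hinj] at h'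
      exact ⟨rfl, h'⟩
    · exact absurd h haS
  · rintro ⟨rfl, h⟩
    refine ⟨hq, Or.inl rfl, ?_⟩
    rw [southWest_insert_of_le (b := (a, _)) (le_refl a), encard_southWest_last hS hinj, h]

/-- Both kinds of corner obey the same rank condition. For `y = v` the new point is above `k - 1`
earlier values. For `y > v` only `k - 2` earlier values are below `y`, but `v` is one more, and the
new point is the southern witness. -/
theorem mem_kCorners_insert_last (hS : ∀ s ∈ S, s.1 < a) (hinj : InjOn Prod.snd S)
    (hSq : S ⊆ quadrant) (hq : (a, v) ∈ quadrant) (hv : v ∉ Prod.snd '' S) (y : ℝ) :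
    (a, y) ∈ kCorners k (insert (a, v) S) ↔ y ∈ insert v (Prod.snd '' S) ∧ v ≤ y ∧
      {z ∈ insert v (Prod.snd '' S) | z < y}.encard + 1 = k := by
  have haS : (a, y) ∉ S := fun h => lt_irrefl _ (hS _ h)
  have hcard : v < y → {z ∈ insert v (Prod.snd '' S) | z < y}.encard =
      {z ∈ Prod.snd '' S | z < y}.encard + 1 := by
    intro hvy
    rw [← encard_insert_of_notMem (a := v) (fun h => hv h.1)]
    congr 1
    ext z
    constructor
    · rintro ⟨rfl | h, h'⟩
      · exact Or.inl rfl
      · exact Or.inr ⟨h, h'⟩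
    · rintro (rfl | h)
      · exact ⟨Or.inl rfl, hvy⟩
      · exact ⟨Or.inr h.1, h.2⟩
  unfold kCorners
  rw [mem_union, mem_kRecords_insert_last hS hinj hq]
  constructor
  · rintro (⟨rfl, h⟩ | ⟨-, h1, h2, ⟨c, hc, hc1, hc2⟩, ⟨d, hd, hd1, hd2⟩⟩)
    · refine ⟨Or.inl rfl, le_rfl, ?_⟩
      convert h using 3
      ext z
      constructor
      · rintro ⟨rfl | h, h'⟩
        · exact absurd h' (lt_irrefl _)
        · exact ⟨h, h'⟩
      · exact fun h => ⟨Or.inr h.1, h.2⟩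
    · have hvy : v < y := by
        rcases hd with rfl | hd
        · exact hd2
        · have := hS d hd
          rw [hd1] at this
          exact absurd this (lt_irrefl _)
      rw [southWest_insert_of_le (b := (a, _)) (le_refl a), encard_southWest_last hS hinj] at h2
      refine ⟨Or.inr ?_, hvy.le, ?_⟩
      · rcases hc with rfl | hc
        · exact absurd hc1 (lt_irrefl _)
        · exact ⟨c, hc, hc2⟩
      · rw [hcard hvy, ← h2, add_assoc]; rfl
  · rintro ⟨hy, hvy, h⟩
    rcases hvy.eq_or_lt with rfl | hvy
    · left
      refine ⟨rfl, ?_⟩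
      convert h using 3
      ext z
      constructor
      · exact fun h => ⟨Or.inr h.1, h.2⟩
      · rintro ⟨rfl | h, h'⟩
        · exact absurd h' (lt_irrefl _)
        · exact ⟨h, h'⟩
    · right
      obtain ⟨c, hc, hcy⟩ : y ∈ Prod.snd '' S := by
        rcases hy with rfl | hy
        · exact absurd hvy (lt_irrefl _)
        · exact hy
      refine ⟨⟨hq.1, ?_⟩, ?_, ?_, ⟨c, Or.inr hc, hS c hc, hcy⟩, ⟨(a, v), Or.inl rfl, rfl, hvy⟩⟩
      · have := (hSq hc).2
        rwa [hcy] at this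
      · rintro (h | h)
        · rw [Prod.mk.injEq] at h
          exact hvy.ne' h.2
        · exact haS h
      · rw [southWest_insert_of_le (b := (a, _)) (le_refl a), encard_southWest_last hS hinj,
          ← h, hcard hvy, add_assoc]; rfl

end Insert

/-! ### The thinning identity for finite sets -/

/-- The graphs of the injective maps with image `V` from a subset of `U`. -/
noncomputable def bijGraphs (U V : Finset ℝ) : Finset (Finset (ℝ × ℝ)) :=
  open scoped Classical in
  (U ×ˢ V).powerset.filter fun S =>
    InjOn Prod.fst (S : Set (ℝ × ℝ)) ∧ InjOn Prod.snd (S : Set (ℝ × ℝ)) ∧ S.image Prod.snd = V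

theorem mem_bijGraphs {U V : Finset ℝ} {S : Finset (ℝ × ℝ)} : S ∈ bijGraphs U V ↔
    S ⊆ U ×ˢ V ∧ InjOn Prod.fst (S : Set (ℝ × ℝ)) ∧ InjOn Prod.snd (S : Set (ℝ × ℝ)) ∧
      S.image Prod.snd = V := by
  simp [bijGraphs]

theorem mem_bijGraphs' {U V : Finset ℝ} {S : Finset (ℝ × ℝ)} : S ∈ bijGraphs U V ↔
    (∀ s ∈ S, s.1 ∈ U) ∧ InjOn Prod.fst (S : Set (ℝ × ℝ)) ∧ InjOn Prod.snd (S : Set (ℝ × ℝ)) ∧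
      S.image Prod.snd = V := by
  rw [mem_bijGraphs]
  constructor
  · rintro ⟨h, h'⟩
    exact ⟨fun s hs => (Finset.mem_product.1 (h hs)).1, h'⟩
  · rintro ⟨h, h1, h2, rfl⟩
    exact ⟨fun s hs => Finset.mem_product.2 ⟨h s hs, Finset.mem_image_of_mem _ hs⟩, h1, h2, rfl⟩

/-- Either the time `a` is unused, or a single point `(a, v)` has this time, and its removal frees
the value `v`. -/
theorem bijGraphs_insert {U V : Finset ℝ} {a : ℝ} (ha : a ∉ U) :
    bijGraphs (insert a U) V = bijGraphs U V ∪
      V.biUnion fun v => (bijGraphs U (V.erase v)).image (insert (a, v)) := by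
  ext S
  simp only [Finset.mem_union, Finset.mem_biUnion, Finset.mem_image]
  constructor
  · intro hS
    obtain ⟨h, h1, h2, h3⟩ := mem_bijGraphs'.1 hS
    by_cases hv : ∃ v, (a, v) ∈ S
    · obtain ⟨v, hv⟩ := hv
      right
      refine ⟨v, h3 ▸ Finset.mem_image_of_mem Prod.snd hv, S.erase (a, v), ?_,
        Finset.insert_erase hv⟩
      refine mem_bijGraphs'.2 ⟨fun s hs => ?_, h1.mono (by simp), h2.mono (by simp), ?_⟩
      · rw [Finset.mem_erase] at hs
        refine Finset.mem_of_mem_insert_of_ne (h s hs.2) fun hsa => hs.1 ?_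
        exact h1 hs.2 hv hsa
      · ext z
        rw [Finset.mem_erase, ← h3]
        simp only [Finset.mem_image, Finset.mem_erase]
        constructor
        · rintro ⟨s, ⟨hs1, hs2⟩, rfl⟩
          exact ⟨fun h' => hs1 (h2 hs2 hv h'), s, hs2, rfl⟩
        · rintro ⟨hz, s, hs, rfl⟩
          exact ⟨s, ⟨fun h' => hz (by rw [h']), hs⟩, rfl⟩
    · left
      refine mem_bijGraphs'.2 ⟨fun s hs => ?_, h1, h2, h3⟩
      exact Finset.mem_of_mem_insert_of_ne (h s hs) fun hsa => hv ⟨s.2, hsa ▸ hs⟩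
  · rintro (hS | ⟨v, hv, S, hS, rfl⟩)
    · obtain ⟨h, h'⟩ := mem_bijGraphs'.1 hS
      exact mem_bijGraphs'.2 ⟨fun s hs => Finset.mem_insert_of_mem (h s hs), h'⟩
    · obtain ⟨h, h1, h2, h3⟩ := mem_bijGraphs'.1 hS
      have haS : (a, v) ∉ (S : Set (ℝ × ℝ)) := fun h' => ha (h _ h')
      refine mem_bijGraphs'.2 ⟨?_, ?_, ?_, ?_⟩
      · intro s hs
        rcases Finset.mem_insert.1 hs with rfl | hs
        · exact Finset.mem_insert_self _ _
        · exact Finset.mem_insert_of_mem (h s hs)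
      · rw [Finset.coe_insert, injOn_insert haS]
        refine ⟨h1, ?_⟩
        rintro ⟨s, hs, hsa⟩
        exact ha ((show s.1 = a from hsa) ▸ h s hs)
      · rw [Finset.coe_insert, injOn_insert haS]
        refine ⟨h2, ?_⟩
        rintro ⟨s, hs, hsa⟩
        have : s.2 ∈ V.erase v := h3 ▸ Finset.mem_image_of_mem Prod.snd hs
        exact Finset.ne_of_mem_erase this hsa
      · rw [Finset.image_insert, h3, Finset.insert_erase hv]

theorem sum_bijGraphs_insert {U V : Finset ℝ} {a : ℝ} (ha : a ∉ U)
    (f : Finset (ℝ × ℝ) → ℝ≥0∞) :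
    ∑ S ∈ bijGraphs (insert a U) V, f S = ∑ S ∈ bijGraphs U V, f S +
      ∑ v ∈ V, ∑ S ∈ bijGraphs U (V.erase v), f (insert (a, v) S) := by
  have haS : ∀ {W : Finset ℝ} {S : Finset (ℝ × ℝ)}, S ∈ bijGraphs U W → ∀ v, (a, v) ∉ S :=
    fun hS v h => ha ((mem_bijGraphs'.1 hS).1 _ h)
  rw [bijGraphs_insert ha, Finset.sum_union, Finset.sum_biUnion]
  · congr 1
    refine Finset.sum_congr rfl fun v _ => Finset.sum_image ?_
    intro S hS T hT hST
    rw [← Finset.erase_insert (haS hS v), ← Finset.erase_insert (haS hT v)]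
    exact congrArg (fun Z => Finset.erase Z (a, v)) hST
  · intro v hv v' hv' hne
    rw [Function.onFun, Finset.disjoint_left]
    intro S hS hS'
    obtain ⟨T, hT, rfl⟩ := Finset.mem_image.1 hS
    obtain ⟨T', hT', h⟩ := Finset.mem_image.1 hS'
    have : (a, v) ∈ insert (a, v') T' := h ▸ Finset.mem_insert_self _ _
    rcases Finset.mem_insert.1 this with h | h
    · exact hne (Prod.mk.inj h).2
    · exact haS hT' v h
  · rw [Finset.disjoint_left]
    intro S hS hS'
    obtain ⟨v, _, hv⟩ := Finset.mem_biUnion.1 hS'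
    obtain ⟨T', _, rfl⟩ := Finset.mem_image.1 hv
    exact haS hS v (Finset.mem_insert_self _ _)

theorem image_mapValue_swap_mem_bijGraphs {U W : Finset ℝ} {v w : ℝ} (hv : v ∈ W) (hw : w ∈ W)
    {S : Finset (ℝ × ℝ)} (hS : S ∈ bijGraphs U (W.erase v)) :
    S.image (mapValue (Equiv.swap v w)) ∈ bijGraphs U (W.erase w) := by
  obtain ⟨h, h1, h2, h3⟩ := mem_bijGraphs'.1 hS
  refine mem_bijGraphs'.2 ⟨?_, ?_, ?_, ?_⟩
  · intro s hs
    obtain ⟨r, hr, rfl⟩ := Finset.mem_image.1 hs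
    exact h r hr
  · rw [Finset.coe_image]
    rintro _ ⟨r, hr, rfl⟩ _ ⟨s, hs, rfl⟩ hrs
    rw [h1 hr hs hrs]
  · rw [Finset.coe_image]
    rintro _ ⟨r, hr, rfl⟩ _ ⟨s, hs, rfl⟩ hrs
    rw [h2 hr hs ((Equiv.swap v w).injective hrs)]
  · have : (S.image (mapValue (Equiv.swap v w))).image Prod.snd =
        (S.image Prod.snd).image (Equiv.swap v w) := by
      rw [Finset.image_image, Finset.image_image]; rfl
    rw [this, h3, Finset.image_erase (Equiv.swap v w).injective, Equiv.swap_apply_left]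
    congr 1
    ext z
    rw [Finset.mem_image]
    constructor
    · rintro ⟨y, hy, rfl⟩
      rw [Equiv.swap_apply_def]
      split_ifs <;> assumption
    · intro hz
      refine ⟨Equiv.swap v w z, ?_, Equiv.swap_apply_self _ _ _⟩
      rw [Equiv.swap_apply_def]
      split_ifs <;> assumption

/-- Omitting `v` and omitting `w` from the values `W` leads to the same sums, for functions of the
set of points that do not depend on the labels of `v` and `w`. -/
theorem sum_bijGraphs_erase_eq {U W : Finset ℝ} {v w : ℝ} (hv : v ∈ W) (hw : w ∈ W)
    (f : Finset (ℝ × ℝ) → ℝ≥0∞)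
    (hf : ∀ S ∈ bijGraphs U (W.erase v), f (S.image (mapValue (Equiv.swap v w))) = f S) :
    ∑ S ∈ bijGraphs U (W.erase v), f S = ∑ S ∈ bijGraphs U (W.erase w), f S := by
  have hinv : ∀ S : Finset (ℝ × ℝ), (S.image (mapValue (Equiv.swap v w))).image
      (mapValue (Equiv.swap v w)) = S := by
    intro S
    rw [Finset.image_image]
    convert Finset.image_id (s := S)
    ext1 s
    exact Prod.ext rfl (Equiv.swap_apply_self _ _ _)
  refine Finset.sum_bij' (fun S _ => S.image (mapValue (Equiv.swap v w)))
    (fun S _ => S.image (mapValue (Equiv.swap v w)))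
    (fun S hS => image_mapValue_swap_mem_bijGraphs hv hw hS) (fun S hS => ?_)
    (fun S _ => hinv S) (fun S _ => hinv S) (fun S hS => (hf S hS).symm)
  have := image_mapValue_swap_mem_bijGraphs hw hv hS
  rwa [Equiv.swap_comm] at this

theorem card_filter_le_of_card_filter_lt {W : Finset ℝ} {w : ℝ} (hw : w ∈ W) :
    (W.filter (· ≤ w)).card = (W.filter (· < w)).card + 1 := by
  rw [← Finset.card_insert_of_notMem (s := W.filter (· < w)) (a := w) (by simp)]
  congr 1
  ext z
  simp only [Finset.mem_filter, Finset.mem_insert, le_iff_lt_or_eq]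
  constructor
  · rintro ⟨h, h' | h'⟩
    exacts [Or.inr ⟨h, h'⟩, Or.inl h']
  · rintro (rfl | h)
    exacts [⟨hw, Or.inr rfl⟩, ⟨h.1, Or.inl h.2⟩]

/-! ### Effect of the last point on a random bijection -/

section LastPoint

variable {k : ℕ} {U V : Finset ℝ} {a v : ℝ} {S : Finset (ℝ × ℝ)}

theorem encard_coe_filter_lt (V : Finset ℝ) (y : ℝ) :
    {z ∈ (V : Set ℝ) | z < y}.encard = ((V.filter (· < y)).card : ℕ∞) := by
  rw [← encard_coe_eq_coe_finsetCard, Finset.coe_filter]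
  rfl

theorem snd_image_of_mem_bijGraphs (hS : S ∈ bijGraphs U V) :
    Prod.snd '' (S : Set (ℝ × ℝ)) = (V : Set ℝ) := by
  rw [← Finset.coe_image, (mem_bijGraphs.1 hS).2.2.2]

theorem mem_quadrant_of_mem_bijGraphs (hU : ∀ u ∈ U, 0 ≤ u) (hV : ∀ u ∈ V, 0 ≤ u)
    (hS : S ∈ bijGraphs U V) : (S : Set (ℝ × ℝ)) ⊆ quadrant := by
  intro s hs
  have := Finset.mem_product.1 ((mem_bijGraphs.1 hS).1 hs)
  exact ⟨hU _ this.1, hV _ this.2⟩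

theorem kRecords_insert_of_mem_bijGraphs (ha : ∀ u ∈ U, u < a) (ha0 : 0 ≤ a)
    (hV : ∀ u ∈ V, 0 ≤ u) (hv : v ∈ V) (hS : S ∈ bijGraphs U (V.erase v)) :
    kRecords k (insert (a, v) (S : Set (ℝ × ℝ))) = kRecords k S ∪
      {b | b = (a, v) ∧ (V.filter (· < v)).card + 1 = k} := by
  have hS' := mem_bijGraphs'.1 hS
  have hlt : ∀ s ∈ (S : Set (ℝ × ℝ)), s.1 < a := fun s hs => ha _ (hS'.1 s hs)
  have hrank : {z ∈ Prod.snd '' (S : Set (ℝ × ℝ)) | z < v}.encard =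
      ((V.filter (· < v)).card : ℕ∞) := by
    rw [snd_image_of_mem_bijGraphs hS, encard_coe_filter_lt]
    congr 2
    ext z
    simp only [Finset.mem_filter, Finset.mem_erase]
    exact ⟨fun h => ⟨h.1.2, h.2⟩, fun h => ⟨⟨h.2.ne, h.1⟩, h.2⟩⟩
  ext ⟨t, y⟩
  by_cases ht : t = a
  · subst ht
    rw [mem_kRecords_insert_last hlt hS'.2.2.1 ⟨ha0, hV v hv⟩, hrank, mem_union]
    have : (t, y) ∉ kRecords k (S : Set (ℝ × ℝ)) :=
      fun h => notMem_kCorners_last hlt y (kRecords_subset_kCorners _ _ h)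
    simp only [this, false_or, mem_ofPred_eq, Prod.mk.injEq, true_and]
    norm_cast
  · rw [mem_kRecords_insert_of_ne hlt ht, mem_union]
    simp [ht]

/-- The new column is described by ranks in the full set `V`: the height of a new corner does not
depend on `v`, which only decides whether the corner is present. -/
theorem kCorners_insert_of_mem_bijGraphs (hU : ∀ u ∈ U, 0 ≤ u) (ha : ∀ u ∈ U, u < a) (ha0 : 0 ≤ a)
    (hV : ∀ u ∈ V, 0 ≤ u) (hv : v ∈ V) (hS : S ∈ bijGraphs U (V.erase v)) :
    kCorners k (insert (a, v) (S : Set (ℝ × ℝ))) = kCorners k S ∪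
      {b | b.1 = a ∧ b.2 ∈ V ∧ v ≤ b.2 ∧ (V.filter (· < b.2)).card + 1 = k} := by
  have hS' := mem_bijGraphs'.1 hS
  have hlt : ∀ s ∈ (S : Set (ℝ × ℝ)), s.1 < a := fun s hs => ha _ (hS'.1 s hs)
  have hVe : ∀ u ∈ V.erase v, 0 ≤ u := fun u hu => hV u (Finset.mem_of_mem_erase hu)
  have hsnd : insert v (Prod.snd '' (S : Set (ℝ × ℝ))) = (V : Set ℝ) := by
    rw [snd_image_of_mem_bijGraphs hS, ← Finset.coe_insert, Finset.insert_erase hv]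
  ext ⟨t, y⟩
  by_cases ht : t = a
  · subst ht
    rw [mem_kCorners_insert_last hlt hS'.2.2.1 (mem_quadrant_of_mem_bijGraphs hU hVe hS)
      ⟨ha0, hV v hv⟩ (by rw [snd_image_of_mem_bijGraphs hS]; simp), hsnd, encard_coe_filter_lt,
      mem_union]
    simp only [notMem_kCorners_last hlt y, false_or, mem_ofPred_eq, Finset.mem_coe, true_and]
    norm_cast
  · rw [mem_kCorners_insert_of_ne hlt ht, mem_union]
    simp [ht]

theorem encard_le_of_mem_bijGraphs (hS : S ∈ bijGraphs U V) (w : ℝ) :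
    {s ∈ (S : Set (ℝ × ℝ)) | s.2 ≤ w}.encard = ((V.filter (· ≤ w)).card : ℕ∞) := by
  rw [← ((mem_bijGraphs.1 hS).2.2.1.mono fun s hs => hs.1 :
    InjOn Prod.snd {s ∈ (S : Set (ℝ × ℝ)) | s.2 ≤ w}).encard_image,
    ← encard_coe_eq_coe_finsetCard, Finset.coe_filter]
  congr 1
  ext z
  simp only [← (mem_bijGraphs.1 hS).2.2.2, Finset.mem_image]
  constructor
  · rintro ⟨s, hs, rfl⟩
    exact ⟨⟨s, hs.1, rfl⟩, hs.2⟩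
  · rintro ⟨⟨s, hs, rfl⟩, h⟩
    exact ⟨s, ⟨hs, h⟩, rfl⟩

end LastPoint

/-- For a uniformly chosen bijection between given times and given values, the `k`-records are a
thinning of the `k`-corners. -/
theorem sum_kRecords_eq_sum_thinSum {k : ℕ} {p q : ℝ≥0∞} (hp : k * p = 1)
    (hq : k * q = (k - 1 : ℕ)) {U V : Finset ℝ} (hU : ∀ u ∈ U, 0 ≤ u) (hV : ∀ v ∈ V, 0 ≤ v)
    (Φ : Set (ℝ × ℝ) → ℝ≥0∞) :
    ∑ S ∈ bijGraphs U V, Φ (kRecords k S) =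
      ∑ S ∈ bijGraphs U V, thinSum p q (cornerFinset k S) Φ := by
  -- The largest time is peeled off. Both `V` and `Φ` vary, since the step uses the values `V.erase
  -- v` and the test function shifted by the new corner.
  induction U using Finset.induction_on_max generalizing V Φ with
  | empty =>
    refine Finset.sum_congr rfl fun S hS => ?_
    have hS0 : S = ∅ := by
      simpa using (mem_bijGraphs.1 hS).1
    subst hS0
    have h1 : cornerFinset k ∅ = ∅ := by
      rw [← Finset.coe_eq_empty, coe_cornerFinset, Finset.coe_empty, ← subset_empty_iff]
      simpa using kCorners_subset_prod k ∅
    have h2 : kRecords k ((∅ : Finset (ℝ × ℝ)) : Set (ℝ × ℝ)) = ∅ := by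
      rw [← subset_empty_iff]
      refine (kRecords_subset_kCorners _ _).trans ?_
      rw [← coe_cornerFinset, h1, Finset.coe_empty]
    rw [h1, h2]
    simp [thinSum]
  | insert a U ha ih =>
    have ha0 : 0 ≤ a := hU a (Finset.mem_insert_self _ _)
    replace hU : ∀ u ∈ U, 0 ≤ u := fun u hu => hU u (Finset.mem_insert_of_mem hu)
    replace ih := fun {V : Finset ℝ} => ih (V := V) hU
    have haU : a ∉ U := fun h => lt_irrefl _ (ha a h)
    have hVe : ∀ v, ∀ u ∈ V.erase v, 0 ≤ u := fun v u hu => hV u (Finset.mem_of_mem_erase hu)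
    rw [sum_bijGraphs_insert haU, sum_bijGraphs_insert haU, ih hV Φ]
    congr 1
    -- No value from `v` upwards has rank `k`: the last column holds neither corner nor record, and
    -- the induction hypothesis suffices.
    have hsame : ∀ v ∈ V, (∀ y ∈ V, v ≤ y → (V.filter (· < y)).card + 1 ≠ k) →
        ∑ S ∈ bijGraphs U (V.erase v), Φ (kRecords k ↑(insert (a, v) S)) =
        ∑ S ∈ bijGraphs U (V.erase v), thinSum p q (cornerFinset k (insert (a, v) S)) Φ := by
      intro v hv hno
      have h1 : ∀ S ∈ bijGraphs U (V.erase v), Φ (kRecords k ↑(insert (a, v) S)) =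
          Φ (kRecords k S) := by
        intro S hS
        rw [Finset.coe_insert, kRecords_insert_of_mem_bijGraphs ha ha0 hV hv hS]
        simp [hno v hv le_rfl]
      have h2 : ∀ S ∈ bijGraphs U (V.erase v), thinSum p q (cornerFinset k (insert (a, v) S)) Φ =
          thinSum p q (cornerFinset k S) Φ := by
        intro S hS
        congr 1
        apply Finset.coe_injective
        rw [coe_cornerFinset, coe_cornerFinset, Finset.coe_insert,
          kCorners_insert_of_mem_bijGraphs hU ha ha0 hV hv hS, union_eq_left]
        rintro b ⟨-, h1, h2, h3⟩
        exact absurd h3 (hno _ h1 h2)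
      rw [Finset.sum_congr rfl h1, Finset.sum_congr rfl h2]
      exact ih (hVe v) Φ
    by_cases hw : ∃ w ∈ V, (V.filter (· < w)).card + 1 = k
    · obtain ⟨w, hwV, hw⟩ := hw
      have huniq : ∀ y ∈ V, (V.filter (· < y)).card + 1 = k → y = w := by
        intro y hy hyk
        by_contra hne
        rcases lt_or_gt_of_ne hne with h | h
        · have : (V.filter (· < y)).card < (V.filter (· < w)).card :=
            Finset.card_lt_card (Finset.ssubset_iff_of_subset (fun z hz => by
              simp only [Finset.mem_filter] at hz ⊢; exact ⟨hz.1, hz.2.trans h⟩) |>.2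
              ⟨y, by simp [hy, h], by simp⟩)
          omega
        · have : (V.filter (· < w)).card < (V.filter (· < y)).card :=
            Finset.card_lt_card (Finset.ssubset_iff_of_subset (fun z hz => by
              simp only [Finset.mem_filter] at hz ⊢; exact ⟨hz.1, hz.2.trans h⟩) |>.2
              ⟨w, by simp [hwV, h], by simp⟩)
          omega
      -- A last value above `w` creates no corner. The `k` last values up to `w` are compared as a
      -- group.
      rw [← Finset.sum_filter_add_sum_filter_not V (· ≤ w),
        ← Finset.sum_filter_add_sum_filter_not V (· ≤ w)
          (fun v => ∑ S ∈ bijGraphs U (V.erase v), thinSum p q _ Φ)]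
      congr 1
      swap
      · refine Finset.sum_congr rfl fun v hv => ?_
        simp only [Finset.mem_filter, not_le] at hv
        refine hsame v hv.1 fun y hy hvy hyk => ?_
        exact absurd (huniq y hy hyk) (hv.2.trans_le hvy).ne'
      set X : (Set (ℝ × ℝ) → ℝ≥0∞) → ℝ≥0∞ := fun Ψ =>
        ∑ S ∈ bijGraphs U (V.erase w), Ψ (kRecords k S) with hX
      -- Without `v`, exactly `k - 1` values up to `w` remain, too few for a record at height at
      -- most `w`. Exchanging the labels `v` and `w` therefore preserves the records.
      have hswap : ∀ v ∈ V, v ≤ w → ∀ Ψ : Set (ℝ × ℝ) → ℝ≥0∞,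
          ∑ S ∈ bijGraphs U (V.erase v), Ψ (kRecords k S) = X Ψ := by
        intro v hv hvw Ψ
        refine sum_bijGraphs_erase_eq hv hwV (fun S => Ψ (kRecords k S)) fun S hS => ?_
        rw [Finset.coe_image, kRecords_mapValue (w := w)]
        · intro y hy
          exact Equiv.swap_apply_of_ne_of_ne (hvw.trans_lt hy).ne' hy.ne'
        · rw [encard_le_of_mem_bijGraphs hS, ← hw, ← card_filter_le_of_card_filter_lt hwV,
            Nat.cast_lt]
          refine Finset.card_lt_card (Finset.ssubset_iff_of_subset (fun z hz => ?_) |>.2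
            ⟨v, by simp [hv, hvw], by simp⟩)
          simp only [Finset.mem_filter, Finset.mem_erase] at hz ⊢
          exact ⟨hz.1.2, hz.2⟩
      -- Each `v ≤ w` creates the same corner `(a, w)`, whose fate is split off. The induction
      -- hypothesis then turns thinned earlier corners into earlier records, for which the exchange
      -- of labels is available.
      have hR : ∀ v ∈ V.filter (· ≤ w), ∑ S ∈ bijGraphs U (V.erase v),
          thinSum p q (cornerFinset k (insert (a, v) S)) Φ =
          q * X Φ + p * X (fun A => Φ (insert (a, w) A)) := by
        intro v hv
        obtain ⟨hv, hvw⟩ := Finset.mem_filter.1 hv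
        have h1 : ∀ S ∈ bijGraphs U (V.erase v),
            thinSum p q (cornerFinset k (insert (a, v) S)) Φ =
            q * thinSum p q (cornerFinset k S) Φ +
              p * thinSum p q (cornerFinset k S) (fun A => Φ (insert (a, w) A)) := by
          intro S hS
          rw [← thinSum_insert]
          · congr 1
            apply Finset.coe_injective
            rw [coe_cornerFinset, Finset.coe_insert, Finset.coe_insert, coe_cornerFinset,
              kCorners_insert_of_mem_bijGraphs hU ha ha0 hV hv hS, insert_eq, union_comm]
            congr 1
            ext ⟨t, y⟩
            simp only [mem_ofPred_eq, mem_singleton_iff, Prod.mk.injEq]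
            constructor
            · rintro ⟨rfl, h1, h2, h3⟩
              exact ⟨rfl, huniq y h1 h3⟩
            · rintro ⟨rfl, rfl⟩
              exact ⟨rfl, hwV, hvw, hw⟩
          · rw [← Finset.mem_coe, coe_cornerFinset]
            exact notMem_kCorners_last (fun s hs => ha _ ((mem_bijGraphs'.1 hS).1 s hs)) w
        rw [Finset.sum_congr rfl h1, Finset.sum_add_distrib, ← Finset.mul_sum, ← Finset.mul_sum,
          ← ih (hVe v), ← ih (hVe v), hswap v hv hvw,
          hswap v hv hvw fun A => Φ (insert (a, w) A)]
      have hwf : w ∈ V.filter (· ≤ w) := Finset.mem_filter.2 ⟨hwV, le_rfl⟩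
      have hL : ∀ v ∈ V.filter (· ≤ w), ∑ S ∈ bijGraphs U (V.erase v),
          Φ (kRecords k ↑(insert (a, v) S)) =
          if v = w then X (fun A => Φ (insert (a, w) A)) else X Φ := by
        intro v hv
        obtain ⟨hv, hvw⟩ := Finset.mem_filter.1 hv
        have h1 : ∀ S ∈ bijGraphs U (V.erase v), Φ (kRecords k ↑(insert (a, v) S)) =
            (if v = w then (fun A => Φ (insert (a, w) A)) else Φ) (kRecords k S) := by
          intro S hS
          rw [Finset.coe_insert, kRecords_insert_of_mem_bijGraphs ha ha0 hV hv hS]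
          split_ifs with h
          · subst h
            simp [hw]
          · have : (V.filter (· < v)).card + 1 ≠ k := fun h' => h (huniq v hv h')
            simp [this]
        rw [Finset.sum_congr rfl h1, hswap v hv hvw]
        split_ifs <;> rfl
      -- Among the `k` values up to `w`, the value `w` gives a record and the other `k - 1` do not.
      -- This matches the total weights `k * p = 1` and `k * q = k - 1`.
      rw [Finset.sum_congr rfl hR, Finset.sum_congr rfl hL, Finset.sum_const,
        card_filter_le_of_card_filter_lt hwV, hw, nsmul_eq_mul, mul_add, ← mul_assoc, ← mul_assoc,
        hp, hq, one_mul, ← Finset.add_sum_erase _ _ hwf,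
        if_pos rfl, add_comm]
      congr 1
      rw [Finset.sum_congr rfl (g := fun _ => X Φ)
        fun v hv => if_neg (Finset.ne_of_mem_erase hv), Finset.sum_const, nsmul_eq_mul,
        Finset.card_erase_of_mem hwf,
        card_filter_le_of_card_filter_lt hwV, hw]
    · push Not at hw
      exact Finset.sum_congr rfl fun v hv => hsame v hv fun y hy _ => hw y hy

/-- The graphs of the injective partial maps from `U` to itself. -/
noncomputable def partialPerms (U : Finset ℝ) : Finset (Finset (ℝ × ℝ)) :=
  open scoped Classical in
  (U ×ˢ U).powerset.filter fun S =>
    InjOn Prod.fst (S : Set (ℝ × ℝ)) ∧ InjOn Prod.snd (S : Set (ℝ × ℝ))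

theorem mem_partialPerms {U : Finset ℝ} {S : Finset (ℝ × ℝ)} : S ∈ partialPerms U ↔
    S ⊆ U ×ˢ U ∧ InjOn Prod.fst (S : Set (ℝ × ℝ)) ∧ InjOn Prod.snd (S : Set (ℝ × ℝ)) := by
  simp [partialPerms]

/-- Group the partial permutations by their set of values. It has as many elements as the graph, so
the weight is constant on each group. -/
theorem sum_partialPerms (U : Finset ℝ) (w : ℕ → ℝ≥0∞) (f : Finset (ℝ × ℝ) → ℝ≥0∞) :
    ∑ S ∈ partialPerms U, f S * w S.card =
      ∑ V ∈ U.powerset, (∑ S ∈ bijGraphs U V, f S) * w V.card := by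
  rw [← Finset.sum_fiberwise_of_maps_to (s := partialPerms U) (t := U.powerset)
    (g := fun S => S.image Prod.snd)]
  · refine Finset.sum_congr rfl fun V hV => ?_
    rw [Finset.sum_mul]
    refine Finset.sum_congr ?_ fun S hS => ?_
    · ext S
      rw [Finset.mem_filter, mem_partialPerms, mem_bijGraphs]
      constructor
      · rintro ⟨⟨h, h1, h2⟩, rfl⟩
        refine ⟨fun s hs => Finset.mem_product.2 ⟨(Finset.mem_product.1 (h hs)).1,
          Finset.mem_image_of_mem _ hs⟩, h1, h2, rfl⟩
      · rintro ⟨h, h1, h2, h3⟩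
        exact ⟨⟨h.trans (Finset.product_subset_product le_rfl (Finset.mem_powerset.1 hV)),
          h1, h2⟩, h3⟩
    · obtain ⟨-, -, h2, h3⟩ := mem_bijGraphs.1 hS
      rw [← h3, Finset.card_image_of_injOn h2]
  · intro S hS
    rw [Finset.mem_powerset]
    intro y hy
    obtain ⟨s, hs, rfl⟩ := Finset.mem_image.1 hy
    exact (Finset.mem_product.1 ((mem_partialPerms.1 hS).1 hs)).2

/-- For a random partial permutation whose probability depends on its size only, the `k`-records
are a thinning of the `k`-corners. -/
theorem sum_partialPerms_kRecords_eq {k : ℕ} {p q : ℝ≥0∞} (hp : k * p = 1)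
    (hq : k * q = (k - 1 : ℕ)) {U : Finset ℝ} (hU : ∀ u ∈ U, 0 ≤ u) (w : ℕ → ℝ≥0∞)
    (Φ : Set (ℝ × ℝ) → ℝ≥0∞) :
    ∑ S ∈ partialPerms U, Φ (kRecords k S) * w S.card =
      ∑ S ∈ partialPerms U, thinSum p q (cornerFinset k S) Φ * w S.card := by
  rw [sum_partialPerms U w fun S => Φ (kRecords k S),
    sum_partialPerms U w fun S => thinSum p q (cornerFinset k S) Φ]
  refine Finset.sum_congr rfl fun V hV => ?_
  rw [sum_kRecords_eq_sum_thinSum hp hq hU fun v hv => hU v (Finset.mem_powerset.1 hV hv)]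

/-! ### Locality of corners and records -/

/-- The points with both coordinates less than `M`. -/
def box (M : ℕ) : Set (ℝ × ℝ) := Iio (M : ℝ) ×ˢ Iio (M : ℝ)

theorem southWest_inter_box {M : ℕ} (T : Set (ℝ × ℝ)) {b : ℝ × ℝ} (hb : b ∈ box M) :
    southWest (T ∩ box M) b = southWest T b := by
  ext s
  constructor
  · rintro ⟨hs, h⟩
    exact ⟨hs.1, h⟩
  · rintro ⟨hs, h⟩
    exact ⟨⟨hs, h.1.trans hb.1, h.2.trans hb.2⟩, h⟩

theorem kRecords_inter_box (k M : ℕ) (T : Set (ℝ × ℝ)) :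
    kRecords k (T ∩ box M) = kRecords k T ∩ box M := by
  ext b
  by_cases hb : b ∈ box M
  · simp only [kRecords, mem_inter_iff, mem_ofPred_eq, southWest_inter_box T hb, hb, and_true]
  · refine iff_of_false (fun h => hb h.2.1.2) (fun h => hb h.2)

/-- The box is closed under moving south and west, and a corner is recognised from the points weakly
south-west of it. -/
theorem kCorners_inter_box (k M : ℕ) (T : Set (ℝ × ℝ)) :
    kCorners k (T ∩ box M) = kCorners k T ∩ box M := by
  ext b
  by_cases hb : b ∈ box M
  · have hc : (∃ c ∈ T ∩ box M, c.1 < b.1 ∧ c.2 = b.2) ↔ ∃ c ∈ T, c.1 < b.1 ∧ c.2 = b.2 := by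
      constructor
      · rintro ⟨c, hc, h⟩
        exact ⟨c, hc.1, h⟩
      · rintro ⟨c, hc, h⟩
        exact ⟨c, ⟨hc, h.1.trans hb.1, h.2.trans_lt hb.2⟩, h⟩
    have hd : (∃ d ∈ T ∩ box M, d.1 = b.1 ∧ d.2 < b.2) ↔ ∃ d ∈ T, d.1 = b.1 ∧ d.2 < b.2 := by
      constructor
      · rintro ⟨c, hc, h⟩
        exact ⟨c, hc.1, h⟩
      · rintro ⟨c, hc, h⟩
        exact ⟨c, ⟨hc, h.1.trans_lt hb.1, h.2.trans hb.2⟩, h⟩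
    unfold kCorners
    rw [kRecords_inter_box, union_inter_distrib_right, mem_union, mem_union,
      mem_inter_iff _ {a | _}, mem_ofPred_eq, mem_ofPred_eq, hc, hd]
    simp only [mem_inter_iff, southWest_inter_box T hb, hb, and_true]
  · refine iff_of_false (fun h => ?_) (fun h => hb h.2)
    obtain ⟨⟨c, hc, hcb⟩, ⟨d, hd, hdb⟩⟩ := kCorners_subset_prod _ _ h
    exact hb ⟨hcb ▸ hc.2.1, hdb ▸ hd.2.2⟩

/-! ### Transport of corners and records under a monotone map -/

section Transport

variable {h : ℝ → ℝ} {T : Set (ℝ × ℝ)} {k : ℕ}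

theorem lt_iff_of_monotone_of_injOn {α : Type*} {h : ℝ → ℝ} (hm : Monotone h) {f : α → ℝ}
    {T : Set α} (hi : InjOn (fun a => h (f a)) T) {a b : α} (ha : a ∈ T) (hb : b ∈ T) :
    h (f a) < h (f b) ↔ f a < f b := by
  refine ⟨fun hab => hm.reflect_lt hab, fun hab => (hm hab.le).lt_of_ne fun he => ?_⟩
  rw [hi ha hb he] at hab
  exact lt_irrefl _ hab

theorem eq_iff_of_injOn {α : Type*} {h : ℝ → ℝ} {f : α → ℝ}
    {T : Set α} (hi : InjOn (fun a => h (f a)) T) {a b : α} (ha : a ∈ T) (hb : b ∈ T) :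
    h (f a) = h (f b) ↔ f a = f b :=
  ⟨fun he => by rw [hi ha hb he], fun he => by rw [he]⟩

/-- Injectivity is needed on the whole product, because a corner of the second kind combines the
time of one point with the value of another. -/
theorem injOn_prodMap (h1 : InjOn (fun a : ℝ × ℝ => h a.1) T)
    (h2 : InjOn (fun a : ℝ × ℝ => h a.2) T) :
    InjOn (Prod.map h h) ((Prod.fst '' T) ×ˢ (Prod.snd '' T)) := by
  rintro ⟨_, _⟩ ⟨⟨a, ha, rfl⟩, ⟨b, hb, rfl⟩⟩ ⟨_, _⟩ ⟨⟨c, hc, rfl⟩, ⟨d, hd, rfl⟩⟩ he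
  rw [Prod.map_apply, Prod.map_apply, Prod.mk.injEq] at he
  rw [h1 ha hc he.1, h2 hb hd he.2]

theorem subset_prod_image (T : Set (ℝ × ℝ)) : T ⊆ (Prod.fst '' T) ×ˢ (Prod.snd '' T) :=
  fun a ha => ⟨⟨a, ha, rfl⟩, ⟨a, ha, rfl⟩⟩

theorem encard_southWest_image (hm : Monotone h) (h1 : InjOn (fun a : ℝ × ℝ => h a.1) T)
    (h2 : InjOn (fun a : ℝ × ℝ => h a.2) T) {b : ℝ × ℝ}
    (hb : b ∈ (Prod.fst '' T) ×ˢ (Prod.snd '' T)) :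
    (southWest (Prod.map h h '' T) (Prod.map h h b)).encard = (southWest T b).encard := by
  have : southWest (Prod.map h h '' T) (Prod.map h h b) = Prod.map h h '' southWest T b := by
    obtain ⟨b1, b2⟩ := b
    obtain ⟨⟨c, hc, rfl⟩, ⟨d, hd, rfl⟩⟩ := hb
    ext s
    constructor
    · rintro ⟨⟨r, hr, rfl⟩, hr1, hr2⟩
      exact ⟨r, ⟨hr, (lt_iff_of_monotone_of_injOn hm h1 hr hc).1 hr1,
        (lt_iff_of_monotone_of_injOn hm h2 hr hd).1 hr2⟩, rfl⟩
    · rintro ⟨r, ⟨hr, hr1, hr2⟩, rfl⟩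
      exact ⟨⟨r, hr, rfl⟩, (lt_iff_of_monotone_of_injOn hm h1 hr hc).2 hr1,
        (lt_iff_of_monotone_of_injOn hm h2 hr hd).2 hr2⟩
  rw [this, InjOn.encard_image]
  exact ((injOn_prodMap h1 h2).mono (subset_prod_image T)).mono fun s hs => hs.1

theorem prodMap_mem_quadrant (hpos : ∀ x, 0 ≤ x → 0 ≤ h x) {b : ℝ × ℝ} (hb : b ∈ quadrant) :
    Prod.map h h b ∈ quadrant := ⟨hpos _ hb.1, hpos _ hb.2⟩

theorem prod_image_subset_quadrant (hT : T ⊆ quadrant) :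
    (Prod.fst '' T) ×ˢ (Prod.snd '' T) ⊆ quadrant := by
  rintro ⟨_, _⟩ ⟨⟨a, ha, rfl⟩, ⟨b, hb, rfl⟩⟩
  exact ⟨(hT ha).1, (hT hb).2⟩

theorem prodMap_mem_kRecords_iff (hm : Monotone h) (hpos : ∀ x, 0 ≤ x → 0 ≤ h x) (hT : T ⊆ quadrant)
    (h1 : InjOn (fun a : ℝ × ℝ => h a.1) T) (h2 : InjOn (fun a : ℝ × ℝ => h a.2) T)
    {b : ℝ × ℝ} (hb : b ∈ (Prod.fst '' T) ×ˢ (Prod.snd '' T)) :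
    Prod.map h h b ∈ kRecords k (Prod.map h h '' T) ↔ b ∈ kRecords k T := by
  have hq := prod_image_subset_quadrant hT hb
  have hmem : Prod.map h h b ∈ Prod.map h h '' T ↔ b ∈ T :=
    (injOn_prodMap h1 h2).mem_image_iff (subset_prod_image T) hb
  simp only [kRecords, mem_ofPred_eq, encard_southWest_image hm h1 h2 hb, hq,
    prodMap_mem_quadrant hpos hq, hmem]

theorem prodMap_mem_kCorners_iff (hm : Monotone h) (hpos : ∀ x, 0 ≤ x → 0 ≤ h x) (hT : T ⊆ quadrant)
    (h1 : InjOn (fun a : ℝ × ℝ => h a.1) T) (h2 : InjOn (fun a : ℝ × ℝ => h a.2) T)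
    {b : ℝ × ℝ} (hb : b ∈ (Prod.fst '' T) ×ˢ (Prod.snd '' T)) :
    Prod.map h h b ∈ kCorners k (Prod.map h h '' T) ↔ b ∈ kCorners k T := by
  have hq := prod_image_subset_quadrant hT hb
  have hmem : Prod.map h h b ∈ Prod.map h h '' T ↔ b ∈ T :=
    (injOn_prodMap h1 h2).mem_image_iff (subset_prod_image T) hb
  have hc : (∃ c ∈ Prod.map h h '' T, c.1 < (Prod.map h h b).1 ∧ c.2 = (Prod.map h h b).2) ↔
      ∃ c ∈ T, c.1 < b.1 ∧ c.2 = b.2 := by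
    obtain ⟨b1, b2⟩ := b
    obtain ⟨⟨e, he, rfl⟩, ⟨f, hf, rfl⟩⟩ := hb
    rw [exists_mem_image]
    refine exists_congr fun r => and_congr_right fun hr => and_congr ?_ ?_
    · exact lt_iff_of_monotone_of_injOn hm h1 hr he
    · exact eq_iff_of_injOn h2 hr hf
  have hd : (∃ c ∈ Prod.map h h '' T, c.1 = (Prod.map h h b).1 ∧ c.2 < (Prod.map h h b).2) ↔
      ∃ c ∈ T, c.1 = b.1 ∧ c.2 < b.2 := by
    obtain ⟨b1, b2⟩ := b
    obtain ⟨⟨e, he, rfl⟩, ⟨f, hf, rfl⟩⟩ := hb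
    rw [exists_mem_image]
    refine exists_congr fun r => and_congr_right fun hr => and_congr ?_ ?_
    · exact eq_iff_of_injOn h1 hr he
    · exact lt_iff_of_monotone_of_injOn hm h2 hr hf
  unfold kCorners
  rw [mem_union, mem_union, prodMap_mem_kRecords_iff hm hpos hT h1 h2 hb, mem_ofPred_eq,
    mem_ofPred_eq, hc, hd, hmem, encard_southWest_image hm h1 h2 hb]
  simp only [hq, prodMap_mem_quadrant hpos hq]

theorem exists_of_mem_kCorners_image {b : ℝ × ℝ} (hb : b ∈ kCorners k (Prod.map h h '' T)) :
    ∃ c ∈ (Prod.fst '' T) ×ˢ (Prod.snd '' T), Prod.map h h c = b := by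
  obtain ⟨⟨_, ⟨c, hc, rfl⟩, hcb⟩, ⟨_, ⟨d, hd, rfl⟩, hdb⟩⟩ := kCorners_subset_prod _ _ hb
  exact ⟨(c.1, d.2), ⟨⟨c, hc, rfl⟩, ⟨d, hd, rfl⟩⟩, Prod.ext hcb hdb⟩

theorem kRecords_image (hm : Monotone h) (hpos : ∀ x, 0 ≤ x → 0 ≤ h x) (hT : T ⊆ quadrant)
    (h1 : InjOn (fun a : ℝ × ℝ => h a.1) T) (h2 : InjOn (fun a : ℝ × ℝ => h a.2) T) :
    kRecords k (Prod.map h h '' T) = Prod.map h h '' kRecords k T := by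
  ext b
  constructor
  · intro hb
    obtain ⟨c, hc, rfl⟩ := exists_of_mem_kCorners_image (kRecords_subset_kCorners _ _ hb)
    exact ⟨c, (prodMap_mem_kRecords_iff hm hpos hT h1 h2 hc).1 hb, rfl⟩
  · rintro ⟨c, hc, rfl⟩
    exact (prodMap_mem_kRecords_iff hm hpos hT h1 h2
      (kCorners_subset_prod _ _ (kRecords_subset_kCorners _ _ hc))).2 hc

theorem kCorners_image (hm : Monotone h) (hpos : ∀ x, 0 ≤ x → 0 ≤ h x) (hT : T ⊆ quadrant)
    (h1 : InjOn (fun a : ℝ × ℝ => h a.1) T) (h2 : InjOn (fun a : ℝ × ℝ => h a.2) T) :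
    kCorners k (Prod.map h h '' T) = Prod.map h h '' kCorners k T := by
  ext b
  constructor
  · intro hb
    obtain ⟨c, hc, rfl⟩ := exists_of_mem_kCorners_image hb
    exact ⟨c, (prodMap_mem_kCorners_iff hm hpos hT h1 h2 hc).1 hb, rfl⟩
  · rintro ⟨c, hc, rfl⟩
    exact (prodMap_mem_kCorners_iff hm hpos hT h1 h2 (kCorners_subset_prod _ _ hc)).2 hc

end Transport

/-! ### Discretisation -/

/-- Round down to a multiple of `1 / L`. -/
noncomputable def floorGrid (L : ℕ) (x : ℝ) : ℝ := ⌊L * x⌋ / L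

/-- Round down both coordinates. -/
noncomputable def gridMap (L : ℕ) : ℝ × ℝ → ℝ × ℝ := Prod.map (floorGrid L) (floorGrid L)

/-- The multiples of `1 / L` in `[0, M)`. -/
noncomputable def grid (M L : ℕ) : Finset ℝ :=
  (Finset.range (M * L)).image fun i : ℕ => (i : ℝ) / L

theorem grid_nonneg {M L : ℕ} : ∀ u ∈ grid M L, 0 ≤ u := by
  intro u hu
  obtain ⟨i, -, rfl⟩ := Finset.mem_image.1 hu
  positivity

theorem card_grid_le (M L : ℕ) : (grid M L).card ≤ M * L :=
  Finset.card_image_le.trans (Finset.card_range _).le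

theorem floorGrid_monotone (L : ℕ) : Monotone (floorGrid L) := by
  intro x y hxy
  unfold floorGrid
  gcongr

theorem floorGrid_nonneg (L : ℕ) (x : ℝ) (hx : 0 ≤ x) : 0 ≤ floorGrid L x := by
  unfold floorGrid
  have : 0 ≤ ⌊L * x⌋ := Int.floor_nonneg.2 (by positivity)
  positivity

theorem measurable_floorGrid (L : ℕ) : Measurable (floorGrid L) := by
  unfold floorGrid
  fun_prop

theorem measurable_gridMap (L : ℕ) : Measurable (gridMap L) :=
  (measurable_floorGrid L).prodMap (measurable_floorGrid L)

theorem floorGrid_preimage {L : ℕ} (hL : 0 < L) (i : ℕ) :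
    floorGrid L ⁻¹' {(i : ℝ) / L} = Ico ((i : ℝ) / L) ((i + 1 : ℝ) / L) := by
  have hLpos : (0 : ℝ) < L := by exact_mod_cast hL
  ext x
  rw [mem_preimage, mem_singleton_iff, floorGrid, div_left_inj' hLpos.ne', mem_Ico, div_le_iff₀ hLpos,
    lt_div_iff₀ hLpos, mul_comm x]
  have : ((⌊L * x⌋ : ℤ) : ℝ) = (i : ℝ) ↔ ⌊L * x⌋ = (i : ℤ) := by
    rw [← Int.cast_natCast (R := ℝ) i, Int.cast_inj]
  rw [this, Int.floor_eq_iff]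
  simp

theorem floorGrid_mem_grid {M L : ℕ} (hL : 0 < L) {x : ℝ} (hx : 0 ≤ x) (hM : x < M) :
    floorGrid L x ∈ grid M L := by
  have hLpos : (0 : ℝ) < L := by exact_mod_cast hL
  have h0 : 0 ≤ ⌊L * x⌋ := Int.floor_nonneg.2 (by positivity)
  lift ⌊L * x⌋ to ℕ using h0 with i hi
  refine Finset.mem_image.2 ⟨i, Finset.mem_range.2 ?_, ?_⟩
  · have h1 : ((i : ℤ) : ℝ) ≤ L * x := hi ▸ Int.floor_le _
    have h2 : (L : ℝ) * x < L * M := by gcongr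
    have h3 : (i : ℝ) < ((M * L : ℕ) : ℝ) := by
      push_cast at h1 ⊢
      linarith
    exact_mod_cast h3
  · rw [floorGrid, ← hi]
    simp

theorem lt_of_floorGrid_mem_grid {M L : ℕ} (hL : 0 < L) {x : ℝ} (hx : floorGrid L x ∈ grid M L) :
    0 ≤ x ∧ x < M := by
  have hLpos : (0 : ℝ) < L := by exact_mod_cast hL
  obtain ⟨i, hi, hix⟩ := Finset.mem_image.1 hx
  have : x ∈ floorGrid L ⁻¹' {(i : ℝ) / L} := hix.symm
  rw [floorGrid_preimage hL] at this
  refine ⟨le_trans (by positivity) this.1, this.2.trans_le ?_⟩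
  rw [div_le_iff₀ hLpos]
  have := Finset.mem_range.1 hi
  exact_mod_cast this

/-- Rounding respects comparison with the multiples of `1 / L`. -/
theorem floorGrid_lt_iff {L : ℕ} (hL : 0 < L) {r : ℝ} {z : ℤ} (hr : L * r = z) (x : ℝ) :
    floorGrid L x < r ↔ x < r := by
  have hLpos : (0 : ℝ) < L := by exact_mod_cast hL
  rw [floorGrid, div_lt_iff₀ hLpos, mul_comm r, hr, Int.cast_lt, Int.floor_lt, ← hr,
    mul_lt_mul_iff_right₀ hLpos]

/-- The configurations in the quadrant with a single point in those cells of the grid of mesh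
`1 / L` in `[0, M)²` that are indexed by `S` and no point in the other cells. -/
def cellEvent (M L : ℕ) (S : Finset (ℝ × ℝ)) : Set (Set (ℝ × ℝ)) :=
  open scoped Classical in
  {T | T ⊆ quadrant ∧ ∀ c ∈ grid M L ×ˢ grid M L,
    (T ∩ gridMap L ⁻¹' {c}).encard = if c ∈ S then 1 else 0}

section CellEvent

variable {M L : ℕ} {S : Finset (ℝ × ℝ)} {T : Set (ℝ × ℝ)}

theorem gridMap_mem (hL : 0 < L) {b : ℝ × ℝ} (hq : b ∈ quadrant) (hb : b ∈ box M) :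
    gridMap L b ∈ grid M L ×ˢ grid M L :=
  Finset.mem_product.2 ⟨floorGrid_mem_grid hL hq.1 hb.1, floorGrid_mem_grid hL hq.2 hb.2⟩

theorem mem_box_of_gridMap_mem (hL : 0 < L) {b : ℝ × ℝ}
    (hb : gridMap L b ∈ grid M L ×ˢ grid M L) : b ∈ quadrant ∩ box M := by
  have h1 := lt_of_floorGrid_mem_grid hL (Finset.mem_product.1 hb).1
  have h2 := lt_of_floorGrid_mem_grid hL (Finset.mem_product.1 hb).2
  exact ⟨⟨h1.1, h2.1⟩, ⟨h1.2, h2.2⟩⟩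

theorem gridMap_image_of_mem_cellEvent (hL : 0 < L) (hS : S ∈ partialPerms (grid M L))
    (hT : T ∈ cellEvent M L S) : gridMap L '' (T ∩ box M) = S := by
  ext c
  constructor
  · rintro ⟨b, ⟨hbT, hbM⟩, rfl⟩
    have hmem := gridMap_mem hL (hT.1 hbT) hbM
    have := hT.2 _ hmem
    by_contra h
    rw [Finset.mem_coe] at h
    rw [if_neg h, encard_eq_zero] at this
    exact this.subset (show b ∈ _ from ⟨hbT, rfl⟩)
  · intro hc
    have hcg := (mem_partialPerms.1 hS).1 hc
    have := hT.2 c hcg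
    rw [if_pos (Finset.mem_coe.1 hc), encard_eq_one] at this
    obtain ⟨b, hb⟩ := this
    have hb' : b ∈ T ∩ gridMap L ⁻¹' {c} := hb ▸ mem_singleton b
    have hbc : gridMap L b = c := hb'.2
    exact ⟨b, ⟨hb'.1, (mem_box_of_gridMap_mem hL (hbc ▸ hcg)).2⟩, hbc⟩

theorem injOn_gridMap_of_mem_cellEvent (hL : 0 < L)
    (hT : T ∈ cellEvent M L S) : InjOn (gridMap L) (T ∩ box M) := by
  rintro a ⟨haT, haM⟩ b ⟨hbT, hbM⟩ hab
  have := hT.2 _ (gridMap_mem hL (hT.1 haT) haM)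
  have hle : (T ∩ gridMap L ⁻¹' {gridMap L a}).encard ≤ 1 := by
    rw [this]; split_ifs <;> simp
  exact encard_le_one_iff.1 hle a b ⟨haT, rfl⟩ ⟨hbT, hab.symm⟩

theorem injOn_fst_of_mem_cellEvent (hL : 0 < L) (hS : S ∈ partialPerms (grid M L))
    (hT : T ∈ cellEvent M L S) : InjOn (fun a : ℝ × ℝ => floorGrid L a.1) (T ∩ box M) := by
  intro a ha b hb hab
  have h := gridMap_image_of_mem_cellEvent hL hS hT
  refine injOn_gridMap_of_mem_cellEvent hL hT ha hb ?_
  exact (mem_partialPerms.1 hS).2.1 (h.subset ⟨a, ha, rfl⟩) (h.subset ⟨b, hb, rfl⟩) hab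

theorem injOn_snd_of_mem_cellEvent (hL : 0 < L) (hS : S ∈ partialPerms (grid M L))
    (hT : T ∈ cellEvent M L S) : InjOn (fun a : ℝ × ℝ => floorGrid L a.2) (T ∩ box M) := by
  intro a ha b hb hab
  have h := gridMap_image_of_mem_cellEvent hL hS hT
  refine injOn_gridMap_of_mem_cellEvent hL hT ha hb ?_
  exact (mem_partialPerms.1 hS).2.2 (h.subset ⟨a, ha, rfl⟩) (h.subset ⟨b, hb, rfl⟩) hab

theorem finite_inter_box_of_mem_cellEvent (hL : 0 < L) (hS : S ∈ partialPerms (grid M L))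
    (hT : T ∈ cellEvent M L S) : (T ∩ box M).Finite := by
  refine Finite.of_finite_image (f := gridMap L) ?_ (injOn_gridMap_of_mem_cellEvent hL hT)
  rw [gridMap_image_of_mem_cellEvent hL hS hT]
  exact S.finite_toSet

/-- On the cell event the points in the box keep distinct times and distinct values after rounding,
so their order pattern survives. -/
theorem kRecords_of_mem_cellEvent (k : ℕ) (hL : 0 < L) (hS : S ∈ partialPerms (grid M L))
    (hT : T ∈ cellEvent M L S) : gridMap L '' (kRecords k T ∩ box M) = kRecords k S := by
  rw [← kRecords_inter_box, ← gridMap_image_of_mem_cellEvent hL hS hT]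
  exact (kRecords_image (floorGrid_monotone L) (floorGrid_nonneg L)
    (inter_subset_left.trans hT.1) (injOn_fst_of_mem_cellEvent hL hS hT)
    (injOn_snd_of_mem_cellEvent hL hS hT)).symm

theorem kCorners_of_mem_cellEvent (k : ℕ) (hL : 0 < L) (hS : S ∈ partialPerms (grid M L))
    (hT : T ∈ cellEvent M L S) : gridMap L '' (kCorners k T ∩ box M) = kCorners k S := by
  rw [← kCorners_inter_box, ← gridMap_image_of_mem_cellEvent hL hS hT]
  exact (kCorners_image (floorGrid_monotone L) (floorGrid_nonneg L)
    (inter_subset_left.trans hT.1) (injOn_fst_of_mem_cellEvent hL hS hT)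
    (injOn_snd_of_mem_cellEvent hL hS hT)).symm

theorem injOn_gridMap_kCorners (k : ℕ) (hL : 0 < L) (hS : S ∈ partialPerms (grid M L))
    (hT : T ∈ cellEvent M L S) : InjOn (gridMap L) (kCorners k T ∩ box M) := by
  rw [← kCorners_inter_box]
  exact (injOn_prodMap (injOn_fst_of_mem_cellEvent hL hS hT)
    (injOn_snd_of_mem_cellEvent hL hS hT)).mono (kCorners_subset_prod _ _)

theorem finite_kCorners_inter_box (k : ℕ) (hL : 0 < L) (hS : S ∈ partialPerms (grid M L))
    (hT : T ∈ cellEvent M L S) : (kCorners k T ∩ box M).Finite := by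
  rw [← kCorners_inter_box]
  exact kCorners_finite k (finite_inter_box_of_mem_cellEvent hL hS hT)

end CellEvent

/-! ### Random measures and their laws -/

theorem pointMeasure_apply {E : Type*} [MeasurableSpace E] (S : Set E) {B : Set E}
    (hB : MeasurableSet B) : pointMeasure S B = (S ∩ B).encard := by
  rw [pointMeasure, Measure.sum_apply _ hB, ← ENNReal.tsum_set_one,
    tsum_subtype (S ∩ B) (fun _ => (1 : ℝ≥0∞)), tsum_subtype S fun a => Measure.dirac a B]
  congr 1
  ext a
  by_cases h1 : a ∈ S <;> by_cases h2 : a ∈ B <;> simp [Measure.dirac_apply' _ hB, h1, h2]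

/-- The points with coordinates less than the given rational numbers. -/
def rect (i : ℚ × ℚ) : Set (ℝ × ℝ) := Iio (i.1 : ℝ) ×ˢ Iio (i.2 : ℝ)

theorem measurableSet_rect (i : ℚ × ℚ) : MeasurableSet (rect i) :=
  measurableSet_Iio.prod measurableSet_Iio

theorem box_eq_rect (M : ℕ) : box M = rect (M, M) := by simp [box, rect]

theorem rect_inter_rect (i j : ℚ × ℚ) : rect i ∩ rect j = rect (i.1 ⊓ j.1, i.2 ⊓ j.2) := by
  rw [rect, rect, prod_inter_prod, Iio_inter_Iio, Iio_inter_Iio, rect]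
  push_cast
  rfl

theorem isPiSystem_range_rect : IsPiSystem (range rect) := by
  rintro _ ⟨i, rfl⟩ _ ⟨j, rfl⟩ -
  exact ⟨_, (rect_inter_rect i j).symm⟩

theorem generateFrom_range_rect :
    (inferInstance : MeasurableSpace (ℝ × ℝ)) = MeasurableSpace.generateFrom (range rect) := by
  have hspan : IsCountablySpanning (⋃ a : ℚ, {Iio (a : ℝ)}) := by
    refine ⟨fun n => Iio ((n : ℚ) : ℝ), fun n => mem_iUnion.2 ⟨n, rfl⟩, ?_⟩
    ext x
    obtain ⟨n, hn⟩ := exists_nat_gt x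
    simp only [mem_iUnion, mem_Iio, mem_univ, iff_true]
    exact ⟨n, by simpa using hn⟩
  have hgen : MeasurableSpace.generateFrom (⋃ a : ℚ, {Iio (a : ℝ)}) =
      (inferInstance : MeasurableSpace ℝ) := by
    rw [← Real.borel_eq_generateFrom_Iio_rat, ← BorelSpace.measurable_eq]
  refine (generateFrom_eq_prod hgen hgen hspan hspan).symm.trans (congrArg _ ?_)
  ext B
  simp only [mem_image2, mem_iUnion, mem_singleton_iff, mem_range]
  constructor
  · rintro ⟨_, ⟨a, rfl⟩, _, ⟨b, rfl⟩, rfl⟩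
    exact ⟨(a, b), rfl⟩
  · rintro ⟨i, rfl⟩
    exact ⟨_, ⟨i.1, rfl⟩, _, ⟨i.2, rfl⟩, rfl⟩

theorem box_monotone : Monotone box := by
  intro m n hmn
  have : (m : ℝ) ≤ n := by exact_mod_cast hmn
  exact prod_mono (Iio_subset_Iio this) (Iio_subset_Iio this)

theorem iUnion_box : ⋃ M, box M = univ := by
  ext a
  obtain ⟨n, hn⟩ := exists_nat_gt (max a.1 a.2)
  simp only [mem_iUnion, mem_univ, iff_true]
  exact ⟨n, (le_max_left _ _).trans_lt hn, (le_max_right _ _).trans_lt hn⟩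

/-- A locally finite random measure is measurable if the masses of rectangles are. -/
theorem measurable_of_rect {Ω : Type*} [MeasurableSpace Ω] {X : Ω → Measure (ℝ × ℝ)}
    (hfin : ∀ ω i, X ω (rect i) ≠ ∞) (hX : ∀ i, Measurable fun ω => X ω (rect i)) :
    Measurable X := by
  -- Restricted to a box the measures are finite, so the π-system of rectangles decides
  -- measurability. Boxes then exhaust the plane.
  have hM : ∀ M, Measurable fun ω => (X ω).restrict (box M) := by
    intro M
    have : ∀ ω, IsFiniteMeasure ((X ω).restrict (box M)) := fun ω =>
      ⟨by rw [Measure.restrict_apply_univ, box_eq_rect]; exact (hfin ω _).lt_top⟩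
    refine Measurable.measure_of_isPiSystem generateFrom_range_rect isPiSystem_range_rect ?_ ?_
    · rintro _ ⟨i, rfl⟩
      simp only [Measure.restrict_apply (measurableSet_rect i), box_eq_rect, rect_inter_rect]
      exact hX _
    · simp only [Measure.restrict_apply_univ, box_eq_rect]
      exact hX _
  refine Measure.measurable_of_measurable_coe _ fun B hB => ?_
  have : (fun ω => X ω B) = fun ω => ⨆ M, (X ω).restrict (box M) B := by
    ext ω
    simp only [Measure.restrict_apply hB]
    rw [← Monotone.measure_iUnion, ← inter_iUnion, iUnion_box, inter_univ]
    exact fun m n hmn => inter_subset_inter_right _ (box_monotone hmn)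
  rw [this]
  exact Measurable.iSup fun M => (Measure.measurable_coe hB).comp (hM M)

/-- The locally finite measures. -/
def locallyFinite : Set (Measure (ℝ × ℝ)) := {ν | ∀ i, ν (rect i) ≠ ∞}

/-- The masses of all rectangles. -/
def rectMasses (ν : Measure (ℝ × ℝ)) (i : ℚ × ℚ) : ℝ≥0∞ := ν (rect i)

theorem measurable_rectMasses : Measurable rectMasses :=
  measurable_pi_lambda _ fun i => Measure.measurable_coe (measurableSet_rect i)

theorem measurableSet_locallyFinite : MeasurableSet locallyFinite := by
  unfold locallyFinite
  simp only [ofPred_forall]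
  refine MeasurableSet.iInter fun i => ?_
  exact (Measure.measurable_coe (measurableSet_rect i)) (measurableSet_singleton ∞).compl

/-- On locally finite measures, events are determined by the masses of rectangles. -/
theorem exists_rectMasses_preimage {U : Set (Measure (ℝ × ℝ))} (hU : MeasurableSet U) :
    ∃ W : Set (ℚ × ℚ → ℝ≥0∞), MeasurableSet W ∧
      rectMasses ⁻¹' W ∩ locallyFinite = U ∩ locallyFinite := by
  classical
  set D : Set (ℚ × ℚ → ℝ≥0∞) := {f | ∀ i, f i ≠ ∞} with hD
  have hDm : MeasurableSet D := by
    simp only [hD, ofPred_forall]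
    exact MeasurableSet.iInter fun i =>
      (measurable_pi_apply i : Measurable fun f : ℚ × ℚ → ℝ≥0∞ => f i)
        (measurableSet_singleton ∞).compl
  -- With the value `0` off the locally finite measures, `X` is locally finite everywhere. It is
  -- then measurable for the σ-algebra generated by `rectMasses`, whose events are preimages under
  -- `rectMasses`.
  let X : Measure (ℝ × ℝ) → Measure (ℝ × ℝ) := fun ν => if rectMasses ν ∈ D then ν else 0
  have hX : @Measurable _ _ (MeasurableSpace.comap rectMasses inferInstance) _ X := by
    refine @measurable_of_rect _ (MeasurableSpace.comap rectMasses inferInstance) X ?_ ?_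
    · intro ν i
      by_cases h : rectMasses ν ∈ D
      · simp only [X, if_pos h]; exact h i
      · simp [X, if_neg h]
    · intro i
      have : (fun ν => X ν (rect i)) = (fun f => D.indicator (fun f => f i) f) ∘ rectMasses := by
        ext ν
        by_cases h : rectMasses ν ∈ D
        · simp only [X, if_pos h, Function.comp, indicator_of_mem h]; rfl
        · simp [X, if_neg h, Function.comp, indicator_of_notMem h]
      rw [this]
      exact ((measurable_pi_apply i).indicator hDm).comp (comap_measurable _)
  obtain ⟨W, hW, hWU⟩ := hX hU
  refine ⟨W, hW, ?_⟩
  rw [hWU]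
  ext ν
  refine and_congr_left fun hν => ?_
  have : rectMasses ν ∈ D := hν
  simp [X, this]

/-- A set of measures determined by the masses of finitely many rectangles. -/
def cylinderSet (I : Finset (ℚ × ℚ)) (t : ℚ × ℚ → Set ℝ≥0∞) : Set (Measure (ℝ × ℝ)) :=
  {ν | ∀ i ∈ I, ν (rect i) ∈ t i}

/-- Pushed forward by `rectMasses`, the measures live on a countable product generated by its
finite-dimensional cylinders. Local finiteness makes this pushforward lose no information. -/
theorem measurable_measure_of_cylinderSet {Ω : Type*} [MeasurableSpace Ω]
    {κ : Ω → Measure (Measure (ℝ × ℝ))} [∀ ω, IsProbabilityMeasure (κ ω)]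
    (hκ : ∀ ω, κ ω locallyFiniteᶜ = 0)
    (h : ∀ I t, (∀ i, MeasurableSet (t i)) → Measurable fun ω => κ ω (cylinderSet I t)) :
    Measurable κ := by
  have : ∀ ω, IsProbabilityMeasure ((κ ω).map rectMasses) := fun ω =>
    Measure.isProbabilityMeasure_map measurable_rectMasses.aemeasurable
  have hmap : Measurable fun ω => (κ ω).map rectMasses := by
    refine Measurable.measure_of_isPiSystem_of_isProbabilityMeasure
      generateFrom_squareCylinders.symm
      (isPiSystem_squareCylinders (fun _ => MeasurableSpace.isPiSystem_measurableSet) (by simp)) ?_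
    rintro _ ⟨I, t, ht, rfl⟩
    have ht' : ∀ i, MeasurableSet (t i) := fun i => ht i (mem_univ i)
    simp only [Measure.map_apply measurable_rectMasses
      (MeasurableSet.pi I.countable_toSet fun i _ => ht' i)]
    exact h I t ht'
  refine Measure.measurable_of_measurable_coe _ fun U hU => ?_
  obtain ⟨W, hW, hWU⟩ := exists_rectMasses_preimage hU
  have : (fun ω => κ ω U) = fun ω => (κ ω).map rectMasses W := by
    ext ω
    rw [Measure.map_apply measurable_rectMasses hW, ← measure_inter_conull (hκ ω), ← hWU,
      measure_inter_conull (hκ ω)]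
  rw [this]
  exact (Measure.measurable_coe hW).comp hmap

theorem measure_ext_of_cylinderSet {μ ν : Measure (Measure (ℝ × ℝ))} [IsProbabilityMeasure μ]
    [IsProbabilityMeasure ν] (hμ : μ locallyFiniteᶜ = 0) (hν : ν locallyFiniteᶜ = 0)
    (h : ∀ I t, (∀ i, MeasurableSet (t i)) → μ (cylinderSet I t) = ν (cylinderSet I t)) :
    μ = ν := by
  have hmap : μ.map rectMasses = ν.map rectMasses := by
    have := Measure.isProbabilityMeasure_map (μ := μ) measurable_rectMasses.aemeasurable
    have := Measure.isProbabilityMeasure_map (μ := ν) measurable_rectMasses.aemeasurable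
    refine ext_of_generate_finite _ generateFrom_squareCylinders.symm
      (isPiSystem_squareCylinders (fun _ => MeasurableSpace.isPiSystem_measurableSet) (by simp)) ?_
      (by simp)
    rintro _ ⟨I, t, ht, rfl⟩
    have ht' : ∀ i, MeasurableSet (t i) := fun i => ht i (mem_univ i)
    simp only [Measure.map_apply measurable_rectMasses
      (MeasurableSet.pi I.countable_toSet fun i _ => ht' i)]
    exact h I t ht'
  ext U hU
  obtain ⟨W, hW, hWU⟩ := exists_rectMasses_preimage hU
  rw [← measure_inter_conull hμ, ← measure_inter_conull hν, ← hWU, measure_inter_conull hμ,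
    measure_inter_conull hν, ← Measure.map_apply measurable_rectMasses hW, hmap,
    Measure.map_apply measurable_rectMasses hW]

/-! ### Bernoulli thinnings of countable sets -/

section Thinning

variable {E : Type*} [MeasurableSpace E]

/-- As a sum over the fixed points of `S`, the mass is visibly measurable in `A` when `S` is
countable, and its mean can be taken term by term. -/
theorem pointMeasure_inter_apply (A S : Set E) {B : Set E} (hB : MeasurableSet B) :
    pointMeasure (A ∩ S) B =
      ∑' a : S, {Z : Set E | (a : E) ∈ Z}.indicator (fun _ => B.indicator 1 (a : E)) A := by
  rw [pointMeasure_apply _ hB, ← ENNReal.tsum_set_one,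
    tsum_subtype (A ∩ S ∩ B) (fun _ => (1 : ℝ≥0∞)), tsum_subtype S fun a =>
      {Z : Set E | (a : E) ∈ Z}.indicator (fun _ => B.indicator (1 : E → ℝ≥0∞) (a : E)) A]
  congr 1
  ext a
  by_cases h1 : a ∈ A <;> by_cases h2 : a ∈ S <;> by_cases h3 : a ∈ B <;>
    simp [h1, h2, h3, indicator]

theorem measurableSet_setOf_mem {E : Type*} (a : E) : MeasurableSet {Z : Set E | a ∈ Z} :=
  measurableSet_setOfPred.2 (by fun_prop)

theorem measurable_pointMeasure_inter {S : Set E} (hS : S.Countable) :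
    Measurable fun A : Set E => pointMeasure (A ∩ S) := by
  refine Measure.measurable_of_measurable_coe _ fun B hB => ?_
  have := hS.to_subtype
  simp only [pointMeasure_inter_apply _ S hB]
  exact Measurable.tsum fun a => measurable_const.indicator (measurableSet_setOf_mem _)

theorem isProbabilityMeasure_bernoulliThinning (p : unitInterval) {S : Set E} (hS : S.Countable) :
    IsProbabilityMeasure (bernoulliThinning p S) :=
  Measure.isProbabilityMeasure_map (measurable_pointMeasure_inter hS).aemeasurable

theorem setBernoulli_setOf_mem {E : Type*} (p : unitInterval) {S : Set E} {a : E} (ha : a ∈ S) :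
    setBernoulli S p {A | a ∈ A} = (unitInterval.toNNReal p : ℝ≥0∞) := by
  rw [setBernoulli_apply']
  have : (fun P : E → Prop => {i | P i}) ⁻¹' {A | a ∈ A} =
      Set.pi ({a} : Finset E) fun _ => {True} := by
    ext P; simp
  rw [this, Measure.infinitePi_pi _ (fun _ _ => .of_discrete)]
  simp [ha]

theorem lintegral_bernoulliThinning (p : unitInterval) {S : Set E} (hS : S.Countable) {B : Set E}
    (hB : MeasurableSet B) : ∫⁻ ν, ν B ∂(bernoulliThinning p S) =
      (unitInterval.toNNReal p : ℝ≥0∞) * pointMeasure S B := by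
  have := hS.to_subtype
  rw [bernoulliThinning, lintegral_map (Measure.measurable_coe hB)
    (measurable_pointMeasure_inter hS)]
  simp only [pointMeasure_inter_apply _ S hB]
  rw [lintegral_tsum fun a =>
    (measurable_const.indicator (measurableSet_setOf_mem _)).aemeasurable]
  simp only [lintegral_indicator_const (measurableSet_setOf_mem _),
    setBernoulli_setOf_mem p (Subtype.coe_prop _)]
  rw [ENNReal.tsum_mul_right, mul_comm]
  congr 1
  have := pointMeasure_inter_apply S S hB
  rw [inter_self] at this
  rw [this]
  refine tsum_congr fun a => ?_
  have ha : S ∈ {Z : Set E | (a : E) ∈ Z} := a.2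
  rw [indicator_of_mem ha]

theorem setBernoulli_inter_eq {E : Type*} (p : unitInterval) {S : Set E} {F A : Finset E}
    (hF : (F : Set E) ⊆ S) (hA : A ⊆ F) :
    setBernoulli S p {Z | Z ∩ F = A} = (unitInterval.toNNReal p : ℝ≥0∞) ^ A.card *
      (unitInterval.toNNReal (unitInterval.symm p) : ℝ≥0∞) ^ (F.card - A.card) := by
  classical
  rw [setBernoulli_apply']
  -- The event prescribes exactly the coordinates in `F`, so its probability is a finite product.
  have : (fun P : E → Prop => {i | P i}) ⁻¹' {Z | Z ∩ F = A} =
      Set.pi F fun a => {P | P ↔ a ∈ A} := by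
    ext P
    simp only [mem_preimage, mem_ofPred_eq, mem_pi, Set.ext_iff, mem_inter_iff, Finset.mem_coe]
    constructor
    · intro h a ha
      rw [← h a]; simp [ha]
    · intro h a
      by_cases ha : a ∈ F
      · simp [ha, h a ha]
      · simpa [ha] using fun h' => ha (hA h')
  rw [this, Measure.infinitePi_pi _ (fun _ _ => .of_discrete),
    ← Finset.prod_sdiff hA, mul_comm]
  congr 1
  · rw [← Finset.prod_const]
    refine Finset.prod_congr rfl fun a ha => ?_
    simp [ha, hF (hA ha)]
  · rw [← Finset.card_sdiff_of_subset hA, ← Finset.prod_const]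
    refine Finset.prod_congr rfl fun a ha => ?_
    rw [Finset.mem_sdiff] at ha
    simp [ha.2, hF ha.1]

theorem measurableSet_setOf_inter_eq {E : Type*} {F A : Finset E} (hA : A ⊆ F) :
    MeasurableSet {Z : Set E | Z ∩ F = A} := by
  have : {Z : Set E | Z ∩ F = A} = ⋂ a ∈ F, {Z : Set E | a ∈ Z ↔ a ∈ A} := by
    ext Z
    simp only [mem_ofPred_eq, mem_iInter, Set.ext_iff, mem_inter_iff, Finset.mem_coe]
    constructor
    · intro h a ha
      rw [← h a]; simp [ha]
    · intro h a
      by_cases ha : a ∈ F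
      · simp [ha, h a ha]
      · simpa [ha] using fun h' => ha (hA h')
  rw [this]
  refine Finset.measurableSet_biInter _ fun a _ => ?_
  by_cases ha : a ∈ A
  · simpa [ha] using measurableSet_setOf_mem a
  · simp only [ha, iff_false]
    exact (measurableSet_setOf_mem a).compl

theorem setBernoulli_inter_mem {E : Type*} (p : unitInterval) {S : Set E} {F : Finset E}
    (hF : (F : Set E) ⊆ S) (Q : Set (Set E)) :
    setBernoulli S p {Z | Z ∩ F ∈ Q} = thinSum (unitInterval.toNNReal p)
      (unitInterval.toNNReal (unitInterval.symm p)) F (Q.indicator 1) := by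
  classical
  have : {Z : Set E | Z ∩ F ∈ Q} =
      ⋃ A ∈ F.powerset.filter fun A : Finset E => (A : Set E) ∈ Q, {Z : Set E | Z ∩ F = A} := by
    ext Z
    simp only [mem_ofPred_eq, mem_iUnion, Finset.mem_filter, Finset.mem_powerset, exists_prop]
    constructor
    · intro h
      have hfin : (Z ∩ F).Finite := F.finite_toSet.subset inter_subset_right
      refine ⟨hfin.toFinset, ⟨?_, by simpa using h⟩, by simp⟩
      rw [← Finset.coe_subset, hfin.coe_toFinset]
      exact inter_subset_right
    · rintro ⟨A, ⟨-, hA⟩, h⟩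
      rwa [h]
  rw [this, measure_biUnion_finset, Finset.sum_filter, thinSum]
  · refine Finset.sum_congr rfl fun A hA => ?_
    rw [setBernoulli_inter_eq p hF (Finset.mem_powerset.1 hA)]
    by_cases h : (A : Set E) ∈ Q <;> simp [h]
  · intro A _ A' _ hne
    rw [Function.onFun, Set.disjoint_left]
    intro Z hZ hZ'
    exact hne (Finset.coe_injective (hZ.symm.trans hZ'))
  · intro A hA
    exact measurableSet_setOf_inter_eq (Finset.mem_powerset.1 (Finset.mem_filter.1 hA).1)

end Thinning

/-! ### Thinnings and cylinder sets -/

theorem pointMeasure_mem_cylinderSet_iff {I : Finset (ℚ × ℚ)} {t : ℚ × ℚ → Set ℝ≥0∞}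
    {A : Set (ℝ × ℝ)} : pointMeasure A ∈ cylinderSet I t ↔
      ∀ i ∈ I, ((A ∩ rect i).encard : ℝ≥0∞) ∈ t i := by
  simp only [cylinderSet, mem_ofPred_eq, pointMeasure_apply _ (measurableSet_rect _)]

theorem rect_subset_box {i : ℚ × ℚ} {M : ℕ} (h1 : i.1 ≤ M) (h2 : i.2 ≤ M) : rect i ⊆ box M := by
  rw [box_eq_rect]
  exact prod_mono (Iio_subset_Iio (by exact_mod_cast h1)) (Iio_subset_Iio (by exact_mod_cast h2))

theorem exists_rect_subset_box (i : ℚ × ℚ) : ∃ M, rect i ⊆ box M := by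
  obtain ⟨M, hM⟩ := exists_nat_ge (max i.1 i.2)
  exact ⟨M, rect_subset_box ((le_max_left _ _).trans hM) ((le_max_right _ _).trans hM)⟩

theorem measurableSet_cylinderSet {I : Finset (ℚ × ℚ)} {t : ℚ × ℚ → Set ℝ≥0∞}
    (ht : ∀ i, MeasurableSet (t i)) : MeasurableSet (cylinderSet I t) := by
  have : cylinderSet I t = ⋂ i ∈ I, (fun ν => ν (rect i)) ⁻¹' t i := by
    ext ν; simp [cylinderSet]
  rw [this]
  exact Finset.measurableSet_biInter _ fun i _ =>
    Measure.measurable_coe (measurableSet_rect i) (ht i)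

theorem pointMeasure_inter_box_mem_cylinderSet_iff {I : Finset (ℚ × ℚ)} {t : ℚ × ℚ → Set ℝ≥0∞}
    {M : ℕ} (hI : ∀ i ∈ I, rect i ⊆ box M) {A : Set (ℝ × ℝ)} :
    pointMeasure (A ∩ box M) ∈ cylinderSet I t ↔ pointMeasure A ∈ cylinderSet I t := by
  simp only [pointMeasure_mem_cylinderSet_iff]
  refine forall₂_congr fun i hi => ?_
  rw [inter_assoc, inter_eq_right.2 (hI i hi)]

/-- If the denominator of `r` divides `L`, then `L * r` is an integer, so the sides of the rectangle
run along grid lines. -/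
theorem gridMap_mem_rect_iff {L : ℕ} (hL : 0 < L) {i : ℚ × ℚ} (h1 : i.1.den ∣ L)
    (h2 : i.2.den ∣ L) (a : ℝ × ℝ) : gridMap L a ∈ rect i ↔ a ∈ rect i := by
  have key : ∀ r : ℚ, r.den ∣ L → ∃ z : ℤ, (L : ℝ) * (r : ℝ) = z := by
    rintro r ⟨m, rfl⟩
    refine ⟨m * r.num, ?_⟩
    have : (r.den : ℝ) * (r : ℝ) = r.num := by exact_mod_cast Rat.den_mul_eq_num r
    push_cast
    rw [← this]
    ring
  obtain ⟨z1, hz1⟩ := key _ h1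
  obtain ⟨z2, hz2⟩ := key _ h2
  exact and_congr (floorGrid_lt_iff hL hz1 _) (floorGrid_lt_iff hL hz2 _)

theorem pointMeasure_gridMap_mem_cylinderSet_iff {I : Finset (ℚ × ℚ)} {t : ℚ × ℚ → Set ℝ≥0∞}
    {L : ℕ} (hL : 0 < L) (hI : ∀ i ∈ I, i.1.den ∣ L ∧ i.2.den ∣ L) {A : Set (ℝ × ℝ)}
    (hA : InjOn (gridMap L) A) :
    pointMeasure (gridMap L '' A) ∈ cylinderSet I t ↔ pointMeasure A ∈ cylinderSet I t := by
  simp only [pointMeasure_mem_cylinderSet_iff]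
  refine forall₂_congr fun i hi => ?_
  have : gridMap L '' A ∩ rect i = gridMap L '' (A ∩ rect i) := by
    ext c
    constructor
    · rintro ⟨⟨a, ha, rfl⟩, hc⟩
      exact ⟨a, ⟨ha, (gridMap_mem_rect_iff hL (hI i hi).1 (hI i hi).2 a).1 hc⟩, rfl⟩
    · rintro ⟨a, ⟨ha, hc⟩, rfl⟩
      exact ⟨⟨a, ha, rfl⟩, (gridMap_mem_rect_iff hL (hI i hi).1 (hI i hi).2 a).2 hc⟩
  rw [this, (hA.mono inter_subset_left).encard_image]

/-- The sets with finitely many points in every box. -/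
def LocFinite (S : Set (ℝ × ℝ)) : Prop := ∀ M, (S ∩ box M).Finite

theorem LocFinite.mono {S T : Set (ℝ × ℝ)} (hT : LocFinite T) (hST : S ⊆ T) : LocFinite S :=
  fun M => (hT M).subset (inter_subset_inter_left _ hST)

theorem LocFinite.countable {S : Set (ℝ × ℝ)} (hS : LocFinite S) : S.Countable := by
  rw [← inter_univ S, ← iUnion_box, inter_iUnion]
  exact countable_iUnion fun M => (hS M).countable

theorem LocFinite.pointMeasure_mem {S : Set (ℝ × ℝ)} (hS : LocFinite S) :
    pointMeasure S ∈ locallyFinite := by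
  intro i
  obtain ⟨M, hM⟩ := exists_rect_subset_box i
  rw [pointMeasure_apply _ (measurableSet_rect i)]
  have := ((hS M).subset (inter_subset_inter_right S hM)).encard_lt_top
  simpa using this.ne

theorem LocFinite.bernoulliThinning_compl {S : Set (ℝ × ℝ)} (hS : LocFinite S) (p : unitInterval) :
    bernoulliThinning p S locallyFiniteᶜ = 0 := by
  rw [bernoulliThinning, Measure.map_apply (measurable_pointMeasure_inter hS.countable)
    measurableSet_locallyFinite.compl]
  convert measure_empty (μ := setBernoulli S p)
  ext A
  simp only [mem_preimage, mem_compl_iff, mem_empty_iff_false, iff_false, not_not]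
  exact (hS.mono inter_subset_right).pointMeasure_mem

theorem LocFinite.bernoulliThinning_cylinderSet {S : Set (ℝ × ℝ)} (hS : LocFinite S)
    (p : unitInterval) {I : Finset (ℚ × ℚ)} {t : ℚ × ℚ → Set ℝ≥0∞} (ht : ∀ i, MeasurableSet (t i))
    {M : ℕ} (hI : ∀ i ∈ I, rect i ⊆ box M) {F : Finset (ℝ × ℝ)} (hF : (F : Set _) = S ∩ box M) :
    bernoulliThinning p S (cylinderSet I t) = thinSum (unitInterval.toNNReal p)
      (unitInterval.toNNReal (unitInterval.symm p)) F
      ((pointMeasure ⁻¹' cylinderSet I t).indicator 1) := by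
  rw [bernoulliThinning, Measure.map_apply (measurable_pointMeasure_inter hS.countable)
    (measurableSet_cylinderSet ht), ← setBernoulli_inter_mem p (hF.le.trans inter_subset_left)]
  congr 1
  ext A
  simp only [mem_preimage, mem_ofPred_eq]
  rw [hF, ← inter_assoc, pointMeasure_inter_box_mem_cylinderSet_iff hI]

/-! ### Corners and records on cell events -/

section CellEvent

variable {M L : ℕ} {S : Finset (ℝ × ℝ)} {T : Set (ℝ × ℝ)} {I : Finset (ℚ × ℚ)}
  {t : ℚ × ℚ → Set ℝ≥0∞}

theorem kRecords_mem_cylinderSet_iff (k : ℕ) (hL : 0 < L) (hS : S ∈ partialPerms (grid M L))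
    (hT : T ∈ cellEvent M L S) (hI : ∀ i ∈ I, rect i ⊆ box M)
    (hIL : ∀ i ∈ I, i.1.den ∣ L ∧ i.2.den ∣ L) :
    pointMeasure (kRecords k T) ∈ cylinderSet I t ↔
      pointMeasure (kRecords k (S : Set (ℝ × ℝ))) ∈ cylinderSet I t := by
  rw [← kRecords_of_mem_cellEvent k hL hS hT, pointMeasure_gridMap_mem_cylinderSet_iff hL hIL,
    pointMeasure_inter_box_mem_cylinderSet_iff hI]
  exact (injOn_gridMap_kCorners k hL hS hT).mono
    (inter_subset_inter_left _ (kRecords_subset_kCorners _ _))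

theorem kCorners_mem_cylinderSet_iff (k : ℕ) (hL : 0 < L) (hS : S ∈ partialPerms (grid M L))
    (hT : T ∈ cellEvent M L S) (hI : ∀ i ∈ I, rect i ⊆ box M)
    (hIL : ∀ i ∈ I, i.1.den ∣ L ∧ i.2.den ∣ L) :
    pointMeasure (kCorners k T) ∈ cylinderSet I t ↔
      pointMeasure (kCorners k (S : Set (ℝ × ℝ))) ∈ cylinderSet I t := by
  rw [← kCorners_of_mem_cellEvent k hL hS hT, pointMeasure_gridMap_mem_cylinderSet_iff hL hIL,
    pointMeasure_inter_box_mem_cylinderSet_iff hI]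
  exact injOn_gridMap_kCorners k hL hS hT

/-- Rounding maps the corners in the box bijectively onto those of `S` and keeps the rectangle
counts of every subset, so the two finite thinning sums agree term by term. -/
theorem bernoulliThinning_kCorners_cylinderSet (k : ℕ) (hL : 0 < L)
    (hS : S ∈ partialPerms (grid M L)) (hT : T ∈ cellEvent M L S)
    (hI : ∀ i ∈ I, rect i ⊆ box M) (hIL : ∀ i ∈ I, i.1.den ∣ L ∧ i.2.den ∣ L)
    (hfin : LocFinite (kCorners k T)) (p : unitInterval) (ht : ∀ i, MeasurableSet (t i)) :
    bernoulliThinning p (kCorners k T) (cylinderSet I t) = thinSum (unitInterval.toNNReal p)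
      (unitInterval.toNNReal (unitInterval.symm p)) (cornerFinset k S)
      ((pointMeasure ⁻¹' cylinderSet I t).indicator 1) := by
  have hinj := injOn_gridMap_kCorners k hL hS hT
  have hF : ((hfin M).toFinset : Set (ℝ × ℝ)) = kCorners k T ∩ box M := by simp
  have hc : cornerFinset k S = (hfin M).toFinset.image (gridMap L) := by
    apply Finset.coe_injective
    rw [coe_cornerFinset, Finset.coe_image, hF, kCorners_of_mem_cellEvent k hL hS hT]
  rw [hfin.bernoulliThinning_cylinderSet p ht hI hF, hc, thinSum_image _ _ (by rwa [hF])]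
  unfold thinSum
  refine Finset.sum_congr rfl fun A hA => ?_
  congr 1
  beta_reduce
  have hA' : InjOn (gridMap L) (A : Set (ℝ × ℝ)) :=
    hinj.mono (hF ▸ Finset.coe_subset.2 (Finset.mem_powerset.1 hA))
  have := pointMeasure_gridMap_mem_cylinderSet_iff (t := t) hL hIL hA'
  by_cases h : pointMeasure (A : Set (ℝ × ℝ)) ∈ cylinderSet I t
  · rw [indicator_of_mem (by exact h), indicator_of_mem (by exact this.2 h)]; rfl
  · rw [indicator_of_notMem (by exact h), indicator_of_notMem (by exact fun h' => h (this.1 h'))]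

end CellEvent

/-! ### The Poisson process on a fine grid -/

/-- The probability is `1 - e⁻ʳ (1 + r)`, and `e⁻ʳ ≥ 1 - r` bounds it by `r²`. -/
theorem poissonMeasure_two_le (r : NNReal) : poissonMeasure r {n | 2 ≤ n} ≤ (r : ℝ≥0∞) ^ 2 := by
  have hc : {n : ℕ | 2 ≤ n} = ((({0, 1} : Finset ℕ) : Set ℕ))ᶜ := by
    ext n
    simp only [mem_ofPred_eq, mem_compl_iff, Finset.coe_insert, Finset.coe_singleton,
      mem_insert_iff, mem_singleton_iff]
    omega
  have h1 : (poissonMeasure r).real {n : ℕ | 2 ≤ n} ≤ (r : ℝ) ^ 2 := by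
    rw [hc, measureReal_compl (Finset.measurableSet _), ← sum_measureReal_singleton,
      Finset.sum_pair (by norm_num), poissonMeasure_real_singleton, poissonMeasure_real_singleton]
    have := Real.add_one_le_exp (-(r : ℝ))
    have hr : (0 : ℝ) ≤ r := r.2
    simp
    nlinarith
  rw [measureReal_def] at h1
  rw [← ENNReal.ofReal_toReal (measure_ne_top (poissonMeasure r) _)]
  refine (ENNReal.ofReal_le_ofReal h1).trans ?_
  rw [ENNReal.ofReal_pow r.coe_nonneg, ENNReal.ofReal_coe_nnreal]

theorem measurableSet_quadrant : MeasurableSet quadrant := measurableSet_Ici.prod measurableSet_Ici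

section Poisson

variable {Ω : Type*} [MeasurableSpace Ω] {Pr : Measure Ω}

theorem IsPoissonPointProcess.measurable_count {E : Type*} [MeasurableSpace E] {P : Ω → Set E}
    {μ : Measure E} (hP : IsPoissonPointProcess P μ Pr) {B : Set E} (hB : MeasurableSet B) :
    Measurable fun ω => pointMeasure (P ω) B :=
  (Measure.measurable_coe hB).comp hP.measurable

theorem IsPoissonPointProcess.measure_two_le {E : Type*} [MeasurableSpace E] {P : Ω → Set E}
    {μ : Measure E} (hP : IsPoissonPointProcess P μ Pr) {B : Set E} (hB : MeasurableSet B)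
    (hμ : μ B ≠ ∞) : Pr {ω | 2 ≤ pointMeasure (P ω) B} ≤ μ B ^ 2 := by
  have hm : MeasurableSet {x : ℝ≥0∞ | 2 ≤ x} := measurableSet_Ici
  rw [(hP.hasLaw_count B hB hμ).measure_eq hm, Measure.map_apply (by fun_prop) hm]
  have : (fun n : ℕ => (n : ℝ≥0∞)) ⁻¹' {x : ℝ≥0∞ | 2 ≤ x} = {n | 2 ≤ n} := by
    ext n
    simp only [mem_preimage, mem_ofPred_eq]
    exact_mod_cast Iff.rfl
  rw [this]
  refine (poissonMeasure_two_le _).trans ?_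
  rw [ENNReal.coe_toNNReal hμ]

theorem IsPoissonPointProcess.measure_count_eq {E : Type*} [MeasurableSpace E] {P : Ω → Set E}
    {μ : Measure E} (hP : IsPoissonPointProcess P μ Pr) {B : Set E} (hB : MeasurableSet B)
    (hμ : μ B ≠ ∞) (n : ℕ) :
    Pr {ω | pointMeasure (P ω) B = n} = poissonMeasure (μ B).toNNReal {n} := by
  have hm : MeasurableSet {x : ℝ≥0∞ | x = n} := measurableSet_singleton _
  rw [(hP.hasLaw_count B hB hμ).measure_eq hm, Measure.map_apply (by fun_prop) hm]
  congr 1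
  ext m
  simp

theorem IsPoissonPointProcess.measure_count_ne_zero {E : Type*} [MeasurableSpace E]
    {P : Ω → Set E} [IsProbabilityMeasure Pr]
    {μ : Measure E} (hP : IsPoissonPointProcess P μ Pr) {B : Set E} (hB : MeasurableSet B)
    (hμ : μ B = 0) : Pr {ω | pointMeasure (P ω) B ≠ 0} = 0 := by
  have h := hP.measure_count_eq hB (by simp [hμ]) 0
  have hm : MeasurableSet {ω | pointMeasure (P ω) B = 0} :=
    hP.measurable_count hB (measurableSet_singleton 0)
  have h1 : {ω | pointMeasure (P ω) B ≠ 0} = {ω | pointMeasure (P ω) B = 0}ᶜ := rfl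
  rw [h1, prob_compl_eq_zero_iff hm]
  simpa [hμ, poissonMeasure_singleton] using h

variable {P : Ω → Set (ℝ × ℝ)}

theorem pointMeasure_eq_zero_iff {E : Type*} [MeasurableSpace E] {S B : Set E}
    (hB : MeasurableSet B) : pointMeasure S B = 0 ↔ S ∩ B = ∅ := by
  rw [pointMeasure_apply _ hB]
  simp

theorem volume_cell {M L : ℕ} (hL : 0 < L) {c : ℝ × ℝ} (hc : c ∈ grid M L ×ˢ grid M L) :
    (volume : Measure (ℝ × ℝ)).restrict quadrant (gridMap L ⁻¹' {c}) =
      ENNReal.ofReal (1 / L) * ENNReal.ofReal (1 / L) := by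
  have hsub : gridMap L ⁻¹' {c} ⊆ quadrant := by
    intro a ha
    have ha' : gridMap L a = c := ha
    exact (mem_box_of_gridMap_mem hL (ha' ▸ hc)).1
  rw [Measure.restrict_apply (measurable_gridMap L (measurableSet_singleton c)),
    inter_eq_left.2 hsub]
  obtain ⟨c1, c2⟩ := c
  obtain ⟨h1, h2⟩ := Finset.mem_product.1 hc
  obtain ⟨i, -, rfl⟩ := Finset.mem_image.1 h1
  obtain ⟨j, -, rfl⟩ := Finset.mem_image.1 h2
  have : gridMap L ⁻¹' {((i : ℝ) / L, (j : ℝ) / L)} =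
      (floorGrid L ⁻¹' {(i : ℝ) / L}) ×ˢ (floorGrid L ⁻¹' {(j : ℝ) / L}) := by
    ext a
    simp [gridMap, Prod.ext_iff]
  rw [this, Measure.volume_eq_prod, Measure.prod_prod, floorGrid_preimage hL,
    floorGrid_preimage hL, Real.volume_Ico, Real.volume_Ico]
  congr 2 <;> ring

/-- The event that the process has the cell configuration `S`. -/
def cellSet {Ω : Type*} (P : Ω → Set (ℝ × ℝ)) (M L : ℕ) (S : Finset (ℝ × ℝ)) : Set Ω :=
  {ω | P ω ∈ cellEvent M L S}

theorem cellSet_eq {Ω : Type*} (P : Ω → Set (ℝ × ℝ)) (M L : ℕ) (S : Finset (ℝ × ℝ)) :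
    cellSet P M L S = {ω | pointMeasure (P ω) quadrantᶜ = 0} ∩
      ⋂ c ∈ grid M L ×ˢ grid M L,
        {ω | pointMeasure (P ω) (gridMap L ⁻¹' {c}) = ((if c ∈ S then 1 else 0 : ℕ) : ℝ≥0∞)} := by
  ext ω
  simp only [cellSet, cellEvent, mem_ofPred_eq, mem_inter_iff, mem_iInter,
    pointMeasure_eq_zero_iff measurableSet_quadrant.compl,
    pointMeasure_apply _ (measurable_gridMap L (measurableSet_singleton _))]
  refine and_congr ?_ (forall₂_congr fun c hc => ?_)
  · rw [← disjoint_iff_inter_eq_empty, disjoint_compl_right_iff_subset]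
  · split_ifs <;> norm_cast

theorem measurableSet_cellSet
    (hP : IsPoissonPointProcess P ((volume : Measure (ℝ × ℝ)).restrict quadrant) Pr)
    (M L : ℕ) (S : Finset (ℝ × ℝ)) : MeasurableSet (cellSet P M L S) := by
  rw [cellSet_eq]
  refine (hP.measurable_count measurableSet_quadrant.compl (measurableSet_singleton 0)).inter ?_
  refine Finset.measurableSet_biInter _ fun c _ => ?_
  exact hP.measurable_count (measurable_gridMap L (measurableSet_singleton c))
    (measurableSet_singleton _)

theorem measure_quadrant_compl_ne [IsProbabilityMeasure Pr]
    (hP : IsPoissonPointProcess P ((volume : Measure (ℝ × ℝ)).restrict quadrant) Pr) :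
    Pr {ω | pointMeasure (P ω) quadrantᶜ ≠ 0} = 0 :=
  hP.measure_count_ne_zero measurableSet_quadrant.compl
    (by rw [Measure.restrict_apply measurableSet_quadrant.compl]; simp)

/-- The probability of a cell configuration depends on its size only. -/
theorem exists_measure_cellSet [IsProbabilityMeasure Pr]
    (hP : IsPoissonPointProcess P ((volume : Measure (ℝ × ℝ)).restrict quadrant) Pr)
    {L : ℕ} (M : ℕ) (hL : 0 < L) :
    ∃ w : ℕ → ℝ≥0∞, ∀ S ⊆ grid M L ×ˢ grid M L, Pr (cellSet P M L S) = w S.card := by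
  set μ := (volume : Measure (ℝ × ℝ)).restrict quadrant
  set v : ℝ≥0∞ := ENNReal.ofReal (1 / L) * ENNReal.ofReal (1 / L) with hv
  have hv' : v ≠ ∞ := ENNReal.mul_ne_top ENNReal.ofReal_ne_top ENNReal.ofReal_ne_top
  set Λ := grid M L ×ˢ grid M L with hΛ
  refine ⟨fun n => poissonMeasure v.toNNReal {1} ^ n *
    poissonMeasure v.toNNReal {0} ^ (Λ.card - n), fun S hS => ?_⟩
  have hcell : ∀ c, MeasurableSet (gridMap L ⁻¹' {c}) := fun c =>
    measurable_gridMap L (measurableSet_singleton c)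
  -- Almost surely no point lies outside the quadrant. What remains is an intersection of
  -- independent events on disjoint cells of equal area.
  rw [cellSet_eq, inter_comm, measure_inter_conull]
  swap
  · exact measure_quadrant_compl_ne hP
  have hind := hP.iIndepFun_count Λ.card (fun i => gridMap L ⁻¹' {(Λ.equivFin.symm i : ℝ × ℝ)})
    (fun i => hcell _) (by
      intro i j hij
      rw [Set.disjoint_left]
      intro a ha hb
      apply hij
      have : (Λ.equivFin.symm i : ℝ × ℝ) = Λ.equivFin.symm j := by
        rw [← show gridMap L a = _ from ha, ← show gridMap L a = _ from hb]
      exact Λ.equivFin.symm.injective (Subtype.ext this))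
  have := hind.measure_inter_preimage_eq_mul Finset.univ
    (sets := fun i => {((if (Λ.equivFin.symm i : ℝ × ℝ) ∈ S then 1 else 0 : ℕ) : ℝ≥0∞)})
    (fun i _ => measurableSet_singleton _)
  have hset : (⋂ c ∈ Λ,
      {ω | pointMeasure (P ω) (gridMap L ⁻¹' {c}) = ((if c ∈ S then 1 else 0 : ℕ) : ℝ≥0∞)}) =
      ⋂ i ∈ (Finset.univ : Finset (Fin Λ.card)),
        (fun ω => pointMeasure (P ω) (gridMap L ⁻¹' {(Λ.equivFin.symm i : ℝ × ℝ)})) ⁻¹'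
          {((if (Λ.equivFin.symm i : ℝ × ℝ) ∈ S then 1 else 0 : ℕ) : ℝ≥0∞)} := by
    ext ω
    simp only [mem_iInter, Finset.mem_univ, forall_true_left, mem_preimage, mem_singleton_iff,
      mem_ofPred_eq]
    constructor
    · intro h i
      exact h _ (Λ.equivFin.symm i).2
    · intro h c hc
      have := h (Λ.equivFin ⟨c, hc⟩)
      simpa only [Equiv.symm_apply_apply] using this
  rw [hset, this]
  have h2 : ∀ c : Λ, Pr ((fun ω => pointMeasure (P ω) (gridMap L ⁻¹' {(c : ℝ × ℝ)})) ⁻¹'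
      {((if (c : ℝ × ℝ) ∈ S then 1 else 0 : ℕ) : ℝ≥0∞)}) =
      if (c : ℝ × ℝ) ∈ S then poissonMeasure v.toNNReal {1} else poissonMeasure v.toNNReal {0} := by
    intro c
    have hvol : μ (gridMap L ⁻¹' {(c : ℝ × ℝ)}) = v := volume_cell hL c.2
    have := hP.measure_count_eq (hcell c) (by rw [hvol]; exact hv')
      (if (c : ℝ × ℝ) ∈ S then 1 else 0)
    rw [hvol] at this
    refine Eq.trans this ?_
    split_ifs <;> rfl
  rw [Finset.prod_congr rfl fun i _ => h2 (Λ.equivFin.symm i),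
    Equiv.prod_comp Λ.equivFin.symm (fun c : Λ => if (c : ℝ × ℝ) ∈ S then
      poissonMeasure v.toNNReal {1} else poissonMeasure v.toNNReal {0}),
    Finset.prod_coe_sort Λ (fun c => if c ∈ S then
      poissonMeasure v.toNNReal {1} else poissonMeasure v.toNNReal {0}), Finset.prod_ite,
    Finset.prod_const, Finset.prod_const, Finset.filter_mem_eq_inter, Finset.inter_eq_right.2 hS]
  congr 2
  rw [← Finset.card_sdiff_of_subset hS, Finset.sdiff_eq_filter]

end Poisson

section Good

variable {Ω : Type*} [MeasurableSpace Ω] {Pr : Measure Ω} {P : Ω → Set (ℝ × ℝ)}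

/-- The points of `[0, M)²` in the column of the grid of mesh `1 / L` at `r`. -/
def columnStrip (M L : ℕ) (r : ℝ) : Set (ℝ × ℝ) := (floorGrid L ⁻¹' {r}) ×ˢ Ico 0 (M : ℝ)

/-- The points of `[0, M)²` in the row of the grid of mesh `1 / L` at `r`. -/
def rowStrip (M L : ℕ) (r : ℝ) : Set (ℝ × ℝ) := Ico 0 (M : ℝ) ×ˢ (floorGrid L ⁻¹' {r})

theorem measurableSet_columnStrip (M L : ℕ) (r : ℝ) : MeasurableSet (columnStrip M L r) :=
  (measurable_floorGrid L (measurableSet_singleton r)).prod measurableSet_Ico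

theorem measurableSet_rowStrip (M L : ℕ) (r : ℝ) : MeasurableSet (rowStrip M L r) :=
  measurableSet_Ico.prod (measurable_floorGrid L (measurableSet_singleton r))

theorem volume_floorGrid_preimage {M L : ℕ} (hL : 0 < L) {r : ℝ} (hr : r ∈ grid M L) :
    volume (floorGrid L ⁻¹' {r}) = ENNReal.ofReal (1 / L) := by
  obtain ⟨i, -, rfl⟩ := Finset.mem_image.1 hr
  rw [floorGrid_preimage hL, Real.volume_Ico]
  congr 1
  ring

theorem volume_columnStrip_le {M L : ℕ} (hL : 0 < L) {r : ℝ} (hr : r ∈ grid M L) :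
    (volume : Measure (ℝ × ℝ)).restrict quadrant (columnStrip M L r) ≤ ENNReal.ofReal (M / L) := by
  refine (Measure.restrict_apply_le _ _).trans ?_
  rw [columnStrip, Measure.volume_eq_prod, Measure.prod_prod, volume_floorGrid_preimage hL hr,
    Real.volume_Ico, ← ENNReal.ofReal_mul (by positivity)]
  refine ENNReal.ofReal_le_ofReal (le_of_eq ?_)
  ring

theorem volume_rowStrip_le {M L : ℕ} (hL : 0 < L) {r : ℝ} (hr : r ∈ grid M L) :
    (volume : Measure (ℝ × ℝ)).restrict quadrant (rowStrip M L r) ≤ ENNReal.ofReal (M / L) := by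
  refine (Measure.restrict_apply_le _ _).trans ?_
  rw [rowStrip, Measure.volume_eq_prod, Measure.prod_prod, volume_floorGrid_preimage hL hr,
    Real.volume_Ico, ← ENNReal.ofReal_mul (by simp)]
  refine ENNReal.ofReal_le_ofReal (le_of_eq ?_)
  ring

/-- A configuration in the quadrant without two points in a row or in a column of the grid has a
cell configuration which is a partial permutation. -/
theorem exists_mem_cellEvent {M L : ℕ} (hL : 0 < L) {T : Set (ℝ × ℝ)} (hT : T ⊆ quadrant)
    (h1 : ∀ r ∈ grid M L, (T ∩ columnStrip M L r).encard ≤ 1)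
    (h2 : ∀ r ∈ grid M L, (T ∩ rowStrip M L r).encard ≤ 1) :
    ∃ S ∈ partialPerms (grid M L), T ∈ cellEvent M L S := by
  classical
  have hcol : ∀ a ∈ T, gridMap L a ∈ grid M L ×ˢ grid M L →
      a ∈ T ∩ columnStrip M L (gridMap L a).1 := by
    intro a ha hg
    have := mem_box_of_gridMap_mem hL hg
    exact ⟨ha, rfl, this.1.2, this.2.2⟩
  have hrow : ∀ a ∈ T, gridMap L a ∈ grid M L ×ˢ grid M L →
      a ∈ T ∩ rowStrip M L (gridMap L a).2 := by
    intro a ha hg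
    have := mem_box_of_gridMap_mem hL hg
    exact ⟨ha, ⟨this.1.1, this.2.1⟩, rfl⟩
  refine ⟨(grid M L ×ˢ grid M L).filter fun c => ∃ a ∈ T, gridMap L a = c,
    mem_partialPerms.2 ⟨Finset.filter_subset _ _, ?_, ?_⟩, hT, ?_⟩
  · intro c hc d hd hcd
    obtain ⟨hcg, a, ha, rfl⟩ := Finset.mem_filter.1 hc
    obtain ⟨hdg, b, hb, rfl⟩ := Finset.mem_filter.1 hd
    have := encard_le_one_iff.1 (h1 _ (Finset.mem_product.1 hcg).1) a b (hcol a ha hcg)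
      (by rw [hcd]; exact hcol b hb hdg)
    rw [this]
  · intro c hc d hd hcd
    obtain ⟨hcg, a, ha, rfl⟩ := Finset.mem_filter.1 hc
    obtain ⟨hdg, b, hb, rfl⟩ := Finset.mem_filter.1 hd
    have := encard_le_one_iff.1 (h2 _ (Finset.mem_product.1 hcg).2) a b (hrow a ha hcg)
      (by rw [hcd]; exact hrow b hb hdg)
    rw [this]
  · intro c hc
    simp only [Finset.mem_filter, hc, true_and]
    split_ifs with h
    · obtain ⟨a, ha, rfl⟩ := h
      refine le_antisymm ((encard_le_encard ?_).trans (h1 _ (Finset.mem_product.1 hc).1))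
        (one_le_encard_iff_nonempty.2 ⟨a, ha, rfl⟩)
      rintro b ⟨hb, hba⟩
      have hba' : gridMap L b = gridMap L a := hba
      have := hcol b hb (hba' ▸ hc)
      rwa [hba'] at this
    · rw [encard_eq_zero, eq_empty_iff_forall_notMem]
      rintro a ⟨ha, hac⟩
      exact h ⟨a, ha, hac⟩

/-- The event that the cell configuration is a partial permutation. -/
def goodSet {Ω : Type*} (P : Ω → Set (ℝ × ℝ)) (M L : ℕ) : Set Ω :=
  ⋃ S ∈ partialPerms (grid M L), cellSet P M L S

theorem measurableSet_goodSet
    (hP : IsPoissonPointProcess P ((volume : Measure (ℝ × ℝ)).restrict quadrant) Pr) (M L : ℕ) :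
    MeasurableSet (goodSet P M L) :=
  Finset.measurableSet_biUnion _ fun S _ => measurableSet_cellSet hP M L S

theorem two_le_of_not_encard_le_one {T B : Set (ℝ × ℝ)} (hB : MeasurableSet B)
    (h : ¬ (T ∩ B).encard ≤ 1) : 2 ≤ pointMeasure T B := by
  rw [pointMeasure_apply _ hB]
  have : (2 : ℕ∞) ≤ (T ∩ B).encard := by
    rw [not_le] at h
    have := Order.add_one_le_of_lt h
    rwa [one_add_one_eq_two] at this
  exact_mod_cast this

/-- Up to a null event, failure puts two points in one of at most `M * L` columns or as many rows.
Each strip has area at most `M / L`, so it fails with probability at most `(M / L) ^ 2`. -/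
theorem measure_goodSet_compl_le [IsProbabilityMeasure Pr]
    (hP : IsPoissonPointProcess P ((volume : Measure (ℝ × ℝ)).restrict quadrant) Pr) (M : ℕ)
    {L : ℕ} (hL : 0 < L) : Pr (goodSet P M L)ᶜ ≤ ENNReal.ofReal (2 * M ^ 3 / L) := by
  have hsub : (goodSet P M L)ᶜ ⊆ {ω | pointMeasure (P ω) quadrantᶜ ≠ 0} ∪
      ((⋃ r ∈ grid M L, {ω | 2 ≤ pointMeasure (P ω) (columnStrip M L r)}) ∪
        ⋃ r ∈ grid M L, {ω | 2 ≤ pointMeasure (P ω) (rowStrip M L r)}) := by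
    intro ω hω
    by_contra hcon
    simp only [mem_union, mem_iUnion, not_or, not_exists, mem_ofPred_eq, not_not] at hcon
    obtain ⟨hq, hc, hr⟩ := hcon
    rw [pointMeasure_eq_zero_iff measurableSet_quadrant.compl, ← disjoint_iff_inter_eq_empty,
      disjoint_compl_right_iff_subset] at hq
    obtain ⟨S, hS, hT⟩ := exists_mem_cellEvent (M := M) hL hq
      (fun r hr' => by_contra fun h =>
        hc r hr' (two_le_of_not_encard_le_one (measurableSet_columnStrip M L r) h))
      (fun r hr' => by_contra fun h =>
        hr r hr' (two_le_of_not_encard_le_one (measurableSet_rowStrip M L r) h))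
    exact hω (mem_biUnion hS hT)
  have hsum : ∀ B : ℝ → Set (ℝ × ℝ), (∀ r, MeasurableSet (B r)) → (∀ r ∈ grid M L,
      (volume : Measure (ℝ × ℝ)).restrict quadrant (B r) ≤ ENNReal.ofReal (M / L)) →
      Pr (⋃ r ∈ grid M L, {ω | 2 ≤ pointMeasure (P ω) (B r)}) ≤ ENNReal.ofReal (M ^ 3 / L) := by
    intro B hB hv
    calc Pr (⋃ r ∈ grid M L, {ω | 2 ≤ pointMeasure (P ω) (B r)})
        ≤ ∑ r ∈ grid M L, Pr {ω | 2 ≤ pointMeasure (P ω) (B r)} := measure_biUnion_finset_le _ _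
      _ ≤ ∑ r ∈ grid M L, ENNReal.ofReal (M / L) ^ 2 := by
          refine Finset.sum_le_sum fun r hr => ?_
          refine (hP.measure_two_le (hB r) ((hv r hr).trans_lt ENNReal.ofReal_lt_top).ne).trans ?_
          gcongr
          exact hv r hr
      _ = (grid M L).card * ENNReal.ofReal (M / L) ^ 2 := by rw [Finset.sum_const, nsmul_eq_mul]
      _ ≤ (M * L : ℕ) * ENNReal.ofReal (M / L) ^ 2 := by
          gcongr
          exact card_grid_le M L
      _ = ENNReal.ofReal (M ^ 3 / L) := by
          rw [← ENNReal.ofReal_pow (by positivity), ← ENNReal.ofReal_natCast,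
            ← ENNReal.ofReal_mul (by positivity)]
          congr 1
          push_cast
          field_simp
  calc Pr (goodSet P M L)ᶜ
      ≤ Pr {ω | pointMeasure (P ω) quadrantᶜ ≠ 0} +
        (Pr (⋃ r ∈ grid M L, {ω | 2 ≤ pointMeasure (P ω) (columnStrip M L r)}) +
          Pr (⋃ r ∈ grid M L, {ω | 2 ≤ pointMeasure (P ω) (rowStrip M L r)})) :=
        (measure_mono hsub).trans ((measure_union_le _ _).trans
          (add_le_add le_rfl (measure_union_le _ _)))
    _ ≤ 0 + (ENNReal.ofReal (M ^ 3 / L) + ENNReal.ofReal (M ^ 3 / L)) :=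
        add_le_add (measure_quadrant_compl_ne hP).le (add_le_add
          (hsum _ (measurableSet_columnStrip M L) fun r hr => volume_columnStrip_le hL hr)
          (hsum _ (measurableSet_rowStrip M L) fun r hr => volume_rowStrip_le hL hr))
    _ = ENNReal.ofReal (2 * M ^ 3 / L) := by
        rw [zero_add, ← ENNReal.ofReal_add (by positivity) (by positivity)]
        congr 1
        ring

/-- The meshes are `1 / n!` because the denominators of finitely many rationals all divide `n!` for
large `n`. -/
theorem tendsto_measure_goodSet_compl [IsProbabilityMeasure Pr]
    (hP : IsPoissonPointProcess P ((volume : Measure (ℝ × ℝ)).restrict quadrant) Pr) (M : ℕ) :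
    Filter.Tendsto (fun n : ℕ => Pr (goodSet P M n.factorial)ᶜ) Filter.atTop (nhds 0) := by
  have h : Filter.Tendsto (fun n : ℕ => ENNReal.ofReal (2 * M ^ 3 / n.factorial)) Filter.atTop
      (nhds 0) := by
    rw [← ENNReal.ofReal_zero]
    refine ENNReal.tendsto_ofReal (Filter.Tendsto.div_atTop tendsto_const_nhds ?_)
    exact tendsto_natCast_atTop_atTop.comp
      (Filter.tendsto_atTop_mono Nat.self_le_factorial Filter.tendsto_id)
  exact tendsto_of_tendsto_of_tendsto_of_le_of_le tendsto_const_nhds h (fun _ => zero_le)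
    fun n => measure_goodSet_compl_le hP M n.factorial_pos

/-- The almost sure event that arbitrarily fine cell configurations of every box are partial
permutations. -/
def regularSet {Ω : Type*} (P : Ω → Set (ℝ × ℝ)) : Set Ω :=
  ⋂ (M : ℕ) (n₀ : ℕ), ⋃ n ≥ n₀, goodSet P M n.factorial

theorem measurableSet_regularSet
    (hP : IsPoissonPointProcess P ((volume : Measure (ℝ × ℝ)).restrict quadrant) Pr) :
    MeasurableSet (regularSet P) :=
  MeasurableSet.iInter fun M => MeasurableSet.iInter fun _ => MeasurableSet.iUnion fun _ =>
    MeasurableSet.iUnion fun _ => measurableSet_goodSet hP M _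

/-- Regularity asks for some good mesh beyond each `n₀`, so it is enough that the failure
probabilities tend to zero; summability plays no role. -/
theorem measure_regularSet_compl [IsProbabilityMeasure Pr]
    (hP : IsPoissonPointProcess P ((volume : Measure (ℝ × ℝ)).restrict quadrant) Pr) :
    Pr (regularSet P)ᶜ = 0 := by
  simp only [regularSet, compl_iInter, measure_iUnion_null_iff]
  intro M n₀
  refine le_antisymm (ge_of_tendsto (tendsto_measure_goodSet_compl hP M) ?_) zero_le
  filter_upwards [Filter.eventually_ge_atTop n₀] with n hn
  refine measure_mono (compl_subset_compl.2 fun ω hω => ?_)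
  exact mem_iUnion₂.2 ⟨n, hn, hω⟩

theorem exists_cellSet_of_mem_regularSet {Ω : Type*} {P : Ω → Set (ℝ × ℝ)} {ω : Ω}
    (hω : ω ∈ regularSet P) (M n₀ : ℕ) :
    ∃ n ≥ n₀, ∃ S ∈ partialPerms (grid M n.factorial), ω ∈ cellSet P M n.factorial S := by
  have := mem_iInter.1 (mem_iInter.1 hω M) n₀
  simpa [goodSet] using this

theorem locFinite_kCorners {Ω : Type*} {P : Ω → Set (ℝ × ℝ)} {ω : Ω}
    (hω : ω ∈ regularSet P) (k : ℕ) :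
    LocFinite (kCorners k (P ω)) := by
  intro M
  obtain ⟨n, -, S, hS, hωS⟩ := exists_cellSet_of_mem_regularSet hω M 0
  exact finite_kCorners_inter_box k n.factorial_pos hS hωS

open scoped Classical in
/-- A function of the process that only depends on the cell configurations is measurable. -/
theorem measurable_of_eq_on_cellSet {β : Type*} [MeasurableSpace β]
    (hP : IsPoissonPointProcess P ((volume : Measure (ℝ × ℝ)).restrict quadrant) Pr)
    {f : Ω → β} (b : β) {M n₀ : ℕ} (v : Finset (ℝ × ℝ) → β)
    (hf : ∀ n ≥ n₀, ∀ S ∈ partialPerms (grid M n.factorial), ∀ ω ∈ regularSet P,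
      ω ∈ cellSet P M n.factorial S → f ω = v S) :
    Measurable fun ω => if ω ∈ regularSet P then f ω else b := by
  intro U hU
  have hreg := measurableSet_regularSet hP
  have : (fun ω => if ω ∈ regularSet P then f ω else b) ⁻¹' U =
      (regularSet P ∩ ⋃ n ≥ n₀, ⋃ S ∈ (partialPerms (grid M n.factorial)).filter (v · ∈ U),
        cellSet P M n.factorial S) ∪ ((regularSet P)ᶜ ∩ {_ω | b ∈ U}) := by
    ext ω
    by_cases hω : ω ∈ regularSet P
    · simp only [mem_preimage, mem_union, mem_inter_iff, hω, true_and, mem_compl_iff,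
        not_true_eq_false, false_and, or_false, mem_iUnion, Finset.mem_filter, exists_prop]
      constructor
      · intro hU
        obtain ⟨n, hn, S, hS, hωS⟩ := exists_cellSet_of_mem_regularSet hω M n₀
        exact ⟨n, hn, S, ⟨hS, hf n hn S hS ω hω hωS ▸ hU⟩, hωS⟩
      · rintro ⟨n, hn, S, ⟨hS, hSU⟩, hωS⟩
        rwa [hf n hn S hS ω hω hωS]
    · simp [hω]
  rw [this]
  refine (hreg.inter ?_).union (hreg.compl.inter (MeasurableSet.const _))
  exact MeasurableSet.iUnion fun n => MeasurableSet.iUnion fun _ =>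
    Finset.measurableSet_biUnion _ fun S _ => measurableSet_cellSet hP M _ S

end Good

/-! ### The thinning identity for the Poisson process -/

theorem natCast_mul_toNNReal_oneDivNat {k : ℕ} (hk : 1 ≤ k) :
    (k : ℝ≥0∞) * (unitInterval.toNNReal (oneDivNat k) : ℝ≥0∞) = 1 := by
  have h : (k : NNReal) * unitInterval.toNNReal (oneDivNat k) = 1 := by
    ext
    have : (k : ℝ) ≠ 0 := by positivity
    simp [oneDivNat, this]
  exact_mod_cast congrArg ((↑) : NNReal → ℝ≥0∞) h

theorem natCast_mul_toNNReal_symm_oneDivNat {k : ℕ} (hk : 1 ≤ k) :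
    (k : ℝ≥0∞) * (unitInterval.toNNReal (unitInterval.symm (oneDivNat k)) : ℝ≥0∞) =
      (k - 1 : ℕ) := by
  have h : (k : NNReal) * unitInterval.toNNReal (unitInterval.symm (oneDivNat k)) =
      (k - 1 : ℕ) := by
    ext
    have : (k : ℝ) ≠ 0 := by positivity
    simp [oneDivNat, hk]
    field_simp
  exact_mod_cast congrArg ((↑) : NNReal → ℝ≥0∞) h

/-- Rational rectangles are eventually compatible with the grids. -/
theorem exists_compatible (I : Finset (ℚ × ℚ)) : ∃ M n₀ : ℕ, (∀ i ∈ I, rect i ⊆ box M) ∧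
    ∀ n ≥ n₀, ∀ i ∈ I, i.1.den ∣ n.factorial ∧ i.2.den ∣ n.factorial := by
  choose m hm using exists_rect_subset_box
  refine ⟨I.sup m, I.sup fun i => max i.1.den i.2.den, fun i hi => (hm i).trans
    (box_monotone (Finset.le_sup hi)), fun n hn i hi => ?_⟩
  have := (Finset.le_sup (f := fun i : ℚ × ℚ => max i.1.den i.2.den) hi).trans hn
  exact ⟨Nat.dvd_factorial i.1.den_pos ((le_max_left _ _).trans this),
    Nat.dvd_factorial i.2.den_pos ((le_max_right _ _).trans this)⟩

section Main

variable {Ω : Type*} [MeasurableSpace Ω] {Pr : Measure Ω} {P : Ω → Set (ℝ × ℝ)}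

open scoped Classical in
/-- The random set `X`, made empty off the regular event. -/
noncomputable def regularize {Ω : Type*} (P X : Ω → Set (ℝ × ℝ)) (ω : Ω) : Set (ℝ × ℝ) :=
  if ω ∈ regularSet P then X ω else ∅

theorem regularize_of_mem {Ω : Type*} {P X : Ω → Set (ℝ × ℝ)} {ω : Ω} (hω : ω ∈ regularSet P) :
    regularize P X ω = X ω := if_pos hω

theorem regularize_of_notMem {Ω : Type*} {P X : Ω → Set (ℝ × ℝ)} {ω : Ω} (hω : ω ∉ regularSet P) :
    regularize P X ω = ∅ := if_neg hω

theorem locFinite_regularize {Ω : Type*} {P X : Ω → Set (ℝ × ℝ)} (k : ℕ)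
    (hX : ∀ ω, X ω ⊆ kCorners k (P ω))
    (ω : Ω) : LocFinite (regularize P X ω) := by
  by_cases hω : ω ∈ regularSet P
  · rw [regularize_of_mem hω]
    exact (locFinite_kCorners hω k).mono (hX ω)
  · rw [regularize_of_notMem hω]
    intro M
    simp

theorem ae_mem_regularSet [IsProbabilityMeasure Pr]
    (hP : IsPoissonPointProcess P ((volume : Measure (ℝ × ℝ)).restrict quadrant) Pr) :
    ∀ᵐ ω ∂Pr, ω ∈ regularSet P := measure_regularSet_compl hP

theorem measurable_regularize_comp {β : Type*} [MeasurableSpace β]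
    (hP : IsPoissonPointProcess P ((volume : Measure (ℝ × ℝ)).restrict quadrant) Pr)
    {X : Ω → Set (ℝ × ℝ)} (g : Set (ℝ × ℝ) → β) {M n₀ : ℕ} (v : Finset (ℝ × ℝ) → β)
    (hg : ∀ n ≥ n₀, ∀ S ∈ partialPerms (grid M n.factorial), ∀ ω ∈ regularSet P,
      ω ∈ cellSet P M n.factorial S → g (X ω) = v S) :
    Measurable fun ω => g (regularize P X ω) := by
  classical
  convert measurable_of_eq_on_cellSet hP (g ∅) v hg using 2 with ω
  by_cases hω : ω ∈ regularSet P
  · rw [regularize_of_mem hω, if_pos hω]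
  · rw [regularize_of_notMem hω, if_neg hω]

theorem measurable_pointMeasure_regularize_kRecords
    (hP : IsPoissonPointProcess P ((volume : Measure (ℝ × ℝ)).restrict quadrant) Pr) (k : ℕ) :
    Measurable fun ω => pointMeasure (regularize P (fun ω => kRecords k (P ω)) ω) := by
  refine measurable_of_rect (fun ω => (locFinite_regularize k
    (fun ω => kRecords_subset_kCorners k (P ω)) ω).pointMeasure_mem) fun i => ?_
  obtain ⟨M, n₀, hM, hn₀⟩ := exists_compatible {i}
  refine measurable_regularize_comp hP (fun T => pointMeasure T (rect i)) (M := M) (n₀ := n₀)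
    (fun S => pointMeasure (kRecords k (S : Set (ℝ × ℝ))) (rect i)) fun n hn S hS ω _ hωS => ?_
  -- With the singleton of the mass computed from `S` as target set, the equivalence of memberships
  -- becomes an equality of masses.
  have := kRecords_mem_cylinderSet_iff (I := {i})
    (t := fun i => {pointMeasure (kRecords k (S : Set (ℝ × ℝ))) (rect i)}) k n.factorial_pos hS
    hωS hM (hn₀ n hn)
  simpa [cylinderSet] using this

theorem measurable_pointMeasure_regularize_kCorners
    (hP : IsPoissonPointProcess P ((volume : Measure (ℝ × ℝ)).restrict quadrant) Pr) (k : ℕ) :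
    Measurable fun ω => pointMeasure (regularize P (fun ω => kCorners k (P ω)) ω) := by
  refine measurable_of_rect (fun ω => (locFinite_regularize k
    (fun ω => Subset.rfl) ω).pointMeasure_mem) fun i => ?_
  obtain ⟨M, n₀, hM, hn₀⟩ := exists_compatible {i}
  refine measurable_regularize_comp hP (fun T => pointMeasure T (rect i)) (M := M) (n₀ := n₀)
    (fun S => pointMeasure (kCorners k (S : Set (ℝ × ℝ))) (rect i)) fun n hn S hS ω _ hωS => ?_
  have := kCorners_mem_cylinderSet_iff (I := {i})
    (t := fun i => {pointMeasure (kCorners k (S : Set (ℝ × ℝ))) (rect i)}) k n.factorial_pos hS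
    hωS hM (hn₀ n hn)
  simpa [cylinderSet] using this

theorem measurable_bernoulliThinning_regularize
    (hP : IsPoissonPointProcess P ((volume : Measure (ℝ × ℝ)).restrict quadrant) Pr) (k : ℕ)
    (p : unitInterval) :
    Measurable fun ω => bernoulliThinning p (regularize P (fun ω => kCorners k (P ω)) ω) := by
  have hfin := locFinite_regularize (P := P) (X := fun ω => kCorners k (P ω)) k
    (fun ω => Subset.rfl)
  have : ∀ ω, IsProbabilityMeasure
      (bernoulliThinning p (regularize P (fun ω => kCorners k (P ω)) ω)) := fun ω =>
    isProbabilityMeasure_bernoulliThinning p (hfin ω).countable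
  refine measurable_measure_of_cylinderSet (fun ω => (hfin ω).bernoulliThinning_compl p)
    fun I t ht => ?_
  obtain ⟨M, n₀, hM, hn₀⟩ := exists_compatible I
  exact measurable_regularize_comp hP (fun T => bernoulliThinning p T (cylinderSet I t)) (M := M)
    (n₀ := n₀) _ fun n hn S hS ω hω hωS => bernoulliThinning_kCorners_cylinderSet k
      n.factorial_pos hS hωS hM (hn₀ n hn) (locFinite_kCorners hω k) p ht

/-- The cell events are disjoint, since rounding recovers `S` from the configuration, and the
integrand is almost surely constant on each. -/
theorem setLIntegral_goodSet [IsProbabilityMeasure Pr]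
    (hP : IsPoissonPointProcess P ((volume : Measure (ℝ × ℝ)).restrict quadrant) Pr) {M L : ℕ}
    (hL : 0 < L) {f : Ω → ℝ≥0∞} {v : Finset (ℝ × ℝ) → ℝ≥0∞}
    (hf : ∀ S ∈ partialPerms (grid M L), ∀ ω ∈ regularSet P, ω ∈ cellSet P M L S → f ω = v S) :
    ∫⁻ ω in goodSet P M L, f ω ∂Pr =
      ∑ S ∈ partialPerms (grid M L), v S * Pr (cellSet P M L S) := by
  rw [goodSet, lintegral_biUnion_finset]
  · refine Finset.sum_congr rfl fun S hS => ?_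
    rw [← setLIntegral_const]
    refine setLIntegral_congr_fun_ae (measurableSet_cellSet hP M L S) ?_
    filter_upwards [ae_mem_regularSet hP] with ω hω hωS
    exact hf S hS ω hω hωS
  · intro S hS S' hS' hne
    rw [Function.onFun, Set.disjoint_left]
    intro ω hω hω'
    apply hne
    apply Finset.coe_injective
    rw [← gridMap_image_of_mem_cellEvent hL hS hω, ← gridMap_image_of_mem_cellEvent hL hS' hω']
  · exact fun S _ => measurableSet_cellSet hP M L S

/-- Off the good event `f` contributes at most the failure probability, which vanishes in the limit.
Applied in both directions, this gives equality. -/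
theorem lintegral_le_of_setLIntegral_goodSet [IsProbabilityMeasure Pr]
    (hP : IsPoissonPointProcess P ((volume : Measure (ℝ × ℝ)).restrict quadrant) Pr) {M n₀ : ℕ}
    {f g : Ω → ℝ≥0∞} (hf : ∀ ω, f ω ≤ 1)
    (hfg : ∀ n ≥ n₀, ∫⁻ ω in goodSet P M n.factorial, f ω ∂Pr =
      ∫⁻ ω in goodSet P M n.factorial, g ω ∂Pr) :
    ∫⁻ ω, f ω ∂Pr ≤ ∫⁻ ω, g ω ∂Pr := by
  have h := (tendsto_const_nhds (x := ∫⁻ ω, g ω ∂Pr)).add (tendsto_measure_goodSet_compl hP M)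
  rw [add_zero] at h
  refine ge_of_tendsto h ?_
  filter_upwards [Filter.eventually_ge_atTop n₀] with n hn
  rw [← lintegral_add_compl f (measurableSet_goodSet hP M n.factorial), hfg n hn]
  refine add_le_add (setLIntegral_le_lintegral _ _) ?_
  refine (lintegral_mono hf).trans ?_
  simp

/-- On a good event both sides are sums over partial permutations with weights depending on the size
only, so `sum_partialPerms_kRecords_eq` applies. The mesh then tends to zero. -/
theorem lintegral_kRecords_eq_lintegral_thinning [IsProbabilityMeasure Pr]
    (hP : IsPoissonPointProcess P ((volume : Measure (ℝ × ℝ)).restrict quadrant) Pr) {k : ℕ}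
    (hk : 1 ≤ k) (I : Finset (ℚ × ℚ)) {t : ℚ × ℚ → Set ℝ≥0∞} (ht : ∀ i, MeasurableSet (t i)) :
    ∫⁻ ω, (cylinderSet I t).indicator 1
        (pointMeasure (regularize P (fun ω => kRecords k (P ω)) ω)) ∂Pr =
      ∫⁻ ω, bernoulliThinning (oneDivNat k) (regularize P (fun ω => kCorners k (P ω)) ω)
        (cylinderSet I t) ∂Pr := by
  have hfin := locFinite_regularize (P := P) (X := fun ω => kCorners k (P ω)) k
    (fun ω => Subset.rfl)
  have hprob : ∀ ω, IsProbabilityMeasure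
      (bernoulliThinning (oneDivNat k) (regularize P (fun ω => kCorners k (P ω)) ω)) := fun ω =>
    isProbabilityMeasure_bernoulliThinning _ (hfin ω).countable
  obtain ⟨M, n₀, hM, hn₀⟩ := exists_compatible I
  have hgood : ∀ n ≥ n₀, ∫⁻ ω in goodSet P M n.factorial, (cylinderSet I t).indicator 1
        (pointMeasure (regularize P (fun ω => kRecords k (P ω)) ω)) ∂Pr =
      ∫⁻ ω in goodSet P M n.factorial, bernoulliThinning (oneDivNat k)
        (regularize P (fun ω => kCorners k (P ω)) ω) (cylinderSet I t) ∂Pr := by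
    intro n hn
    obtain ⟨w, hw⟩ := exists_measure_cellSet hP M n.factorial_pos
    have hw' : ∀ S ∈ partialPerms (grid M n.factorial),
        Pr (cellSet P M n.factorial S) = w S.card := fun S hS => hw S (mem_partialPerms.1 hS).1
    rw [setLIntegral_goodSet hP n.factorial_pos (v := fun S =>
        (pointMeasure ⁻¹' cylinderSet I t).indicator 1 (kRecords k (S : Set (ℝ × ℝ)))),
      setLIntegral_goodSet hP n.factorial_pos (v := fun S =>
        thinSum (unitInterval.toNNReal (oneDivNat k))
          (unitInterval.toNNReal (unitInterval.symm (oneDivNat k))) (cornerFinset k S)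
          ((pointMeasure ⁻¹' cylinderSet I t).indicator 1)),
      Finset.sum_congr rfl fun S hS => by rw [hw' S hS],
      sum_partialPerms_kRecords_eq (natCast_mul_toNNReal_oneDivNat hk)
        (natCast_mul_toNNReal_symm_oneDivNat hk) grid_nonneg]
    · exact Finset.sum_congr rfl fun S hS => by rw [hw' S hS]
    · intro S hS ω hω hωS
      rw [regularize_of_mem hω]
      exact bernoulliThinning_kCorners_cylinderSet k n.factorial_pos hS hωS hM (hn₀ n hn)
        (locFinite_kCorners hω k) _ ht
    · intro S hS ω hω hωS
      rw [regularize_of_mem hω]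
      have := kRecords_mem_cylinderSet_iff (t := t) k n.factorial_pos hS hωS hM (hn₀ n hn)
      by_cases h : pointMeasure (kRecords k (P ω)) ∈ cylinderSet I t
      · rw [indicator_of_mem h, indicator_of_mem (by exact this.1 h)]; rfl
      · rw [indicator_of_notMem h, indicator_of_notMem (by exact fun h' => h (this.2 h'))]
  refine le_antisymm (lintegral_le_of_setLIntegral_goodSet hP (fun ω => ?_) hgood)
    (lintegral_le_of_setLIntegral_goodSet hP (fun ω => prob_le_one)
      fun n hn => (hgood n hn).symm)
  exact indicator_le_self' (fun _ _ => zero_le) _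

end Main

/-- Let `P` be the Poisson point process of unit intensity in the quadrant and `k ≥ 1`. The
`k`-record process has the law of the Bernoulli thinning of the `k`-corner process with retention
probability `1 / k`; and the intensity measure of the `k`-corner process is `k` times that of the
`k`-record process. -/
theorem proposition2 {Ω : Type*} [MeasurableSpace Ω] (Pr : Measure Ω) [IsProbabilityMeasure Pr]
    (P : Ω → Set (ℝ × ℝ))
    (hP : IsPoissonPointProcess P ((volume : Measure (ℝ × ℝ)).restrict quadrant) Pr)
    (k : ℕ) (hk : 1 ≤ k) :
    AEMeasurable (fun ω => pointMeasure (kCorners k (P ω))) Pr ∧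
    HasLaw (fun ω => pointMeasure (kRecords k (P ω)))
      (bernoulliThinningLaw (oneDivNat k) (fun ω => kCorners k (P ω)) Pr) Pr ∧
    ∀ B : Set (ℝ × ℝ), MeasurableSet B →
      ∫⁻ ω, pointMeasure (kCorners k (P ω)) B ∂Pr =
        k * ∫⁻ ω, pointMeasure (kRecords k (P ω)) B ∂Pr := by
  have hreg := ae_mem_regularSet hP
  set C := regularize P fun ω => kCorners k (P ω) with hC
  set R := regularize P fun ω => kRecords k (P ω) with hR
  have hCfin : ∀ ω, LocFinite (C ω) := locFinite_regularize k fun ω => Subset.rfl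
  have hRfin : ∀ ω, LocFinite (R ω) :=
    locFinite_regularize k fun ω => kRecords_subset_kCorners k (P ω)
  have hCeq : ∀ᵐ ω ∂Pr, C ω = kCorners k (P ω) := hreg.mono fun ω hω => regularize_of_mem hω
  have hReq : ∀ᵐ ω ∂Pr, R ω = kRecords k (P ω) := hreg.mono fun ω hω => regularize_of_mem hω
  have hCm : Measurable fun ω => pointMeasure (C ω) :=
    measurable_pointMeasure_regularize_kCorners hP k
  have hRm : Measurable fun ω => pointMeasure (R ω) :=
    measurable_pointMeasure_regularize_kRecords hP k
  have hκ : Measurable fun ω => bernoulliThinning (oneDivNat k) (C ω) :=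
    measurable_bernoulliThinning_regularize hP k (oneDivNat k)
  have hprob : ∀ ω, IsProbabilityMeasure (bernoulliThinning (oneDivNat k) (C ω)) := fun ω =>
    isProbabilityMeasure_bernoulliThinning _ (hCfin ω).countable
  -- Measurability is established for the regularized corners, and a mixture over `Pr` ignores null
  -- events.
  have hbind : bernoulliThinningLaw (oneDivNat k) (fun ω => kCorners k (P ω)) Pr =
      Pr.bind fun ω => bernoulliThinning (oneDivNat k) (C ω) :=
    Measure.bind_congr_right (hCeq.mono fun ω hω => by simp only [hω])
  have hlaw : Pr.map (fun ω => pointMeasure (R ω)) =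
      Pr.bind fun ω => bernoulliThinning (oneDivNat k) (C ω) := by
    have := Measure.isProbabilityMeasure_map (μ := Pr) hRm.aemeasurable
    have : IsProbabilityMeasure (Pr.bind fun ω => bernoulliThinning (oneDivNat k) (C ω)) :=
      isProbabilityMeasure_bind hκ.aemeasurable (Filter.Eventually.of_forall hprob)
    refine measure_ext_of_cylinderSet ?_ ?_ fun I t ht => ?_
    · rw [Measure.map_apply hRm measurableSet_locallyFinite.compl]
      convert measure_empty (μ := Pr)
      ext ω
      simpa using (hRfin ω).pointMeasure_mem
    · rw [Measure.bind_apply measurableSet_locallyFinite.compl hκ.aemeasurable]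
      simp only [fun ω => (hCfin ω).bernoulliThinning_compl (oneDivNat k), lintegral_zero]
    · rw [Measure.bind_apply (measurableSet_cylinderSet ht) hκ.aemeasurable,
        ← lintegral_kRecords_eq_lintegral_thinning hP hk I ht,
        ← lintegral_indicator_one (measurableSet_cylinderSet ht),
        lintegral_map (measurable_one.indicator (measurableSet_cylinderSet ht)) hRm]
  have hRlaw : HasLaw (fun ω => pointMeasure (kRecords k (P ω)))
      (bernoulliThinningLaw (oneDivNat k) (fun ω => kCorners k (P ω)) Pr) Pr := by
    have : HasLaw (fun ω => pointMeasure (R ω))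
        (bernoulliThinningLaw (oneDivNat k) (fun ω => kCorners k (P ω)) Pr) Pr :=
      ⟨hRm.aemeasurable, hlaw.trans hbind.symm⟩
    exact this.congr (hReq.mono fun ω hω => by simp only [hω])
  refine ⟨hCm.aemeasurable.congr (hCeq.mono fun ω hω => ?_), hRlaw, fun B hB => ?_⟩
  · simp only [← hω, hC]
  -- The intensity of the records depends on their law only. Under the thinning law, the conditional
  -- mean given the corners is `1 / k` times their number in `B`.
  · have h1 : ∫⁻ ω, pointMeasure (kRecords k (P ω)) B ∂Pr =
        ∫⁻ ν, ν B ∂(Pr.map fun ω => pointMeasure (R ω)) := by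
      rw [lintegral_map (Measure.measurable_coe hB) hRm]
      exact lintegral_congr_ae (hReq.mono fun ω hω => by simp only [hω])
    rw [h1, hlaw, Measure.lintegral_bind hκ.aemeasurable
      (Measure.measurable_coe hB).aemeasurable]
    simp only [fun ω => lintegral_bernoulliThinning (oneDivNat k) (hCfin ω).countable hB]
    have hCB : Measurable fun ω => pointMeasure (C ω) B := (Measure.measurable_coe hB).comp hCm
    rw [lintegral_const_mul _ hCB, ← mul_assoc,
      natCast_mul_toNNReal_oneDivNat hk, one_mul]
    exact lintegral_congr_ae (hCeq.mono fun ω hω => by simp only [hω])
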